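/- Let $n\ge 1$, $a=\exp(2\pi i/2n)$, and let $\tilde D=\mathrm{diag}(1,a,\dots,a^{2n-1})$ and $\tilde S$ (the cyclic shift, with entries $1$ in the positions $(i,i+1)$, indices modulo $2n$) be Sylvester's generators, regarded as an even and an odd supermatrix on the $(n|n)$-dimensional complex superspace with alternating format (even, odd, even, odd, …). Let $F$ be the free complex Lie superalgebra on an even generator $D$ and an odd generator $S$, and let $\mathrm{ev}:F\to\mathfrak{gl}(n|n)$ be the morphism with $D\mapsto\tilde D$, $S\mapsto\tilde S$. A set of homogeneous elements of $F$ is called a defining set of relations if the ideal that it generates is $\ker(\mathrm{ev})$; let $R(n)$, the number of independent relations between Sylvester's generators, be the least number of elements of a defining set of relations. For $1\le k,m\le 2n$ put $T_m^k=(\mathrm{ad}\,D)^{k-1}(\mathrm{ad}\,S)^{m-1}[D,S]$ if $m<2n$, and $T_{2n}^k=[S,T_{2n-1}^k]$. (1) If $n=1$, then $\tilde D,\tilde S$ generate $\mathfrak{gl}(1|1)$, the relations $$[D,[D,S]]=4S,\quad [S,[D,S]]=0,\quad [D,[S,S]]=0,\quad [S,[S,S]]=0$$ form a defining set, and $R(1)\le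 4$. (2) If $n>1$, then $\tilde D,\tilde S$ generate $\mathfrak{sl}(n|n)$, and $R(n)\le (2n)^2-1$. Moreover $\mathrm{ev}(T_{2n}^{2n})$ is a nonzero multiple of the identity matrix; the two paths $(\mathrm{ad}\,D)(\mathrm{ad}\,S)(\mathrm{ad}\,D)S$ and $(\mathrm{ad}\,S)(\mathrm{ad}\,D)^2S$ to $T_2^2$ are linearly independent in $F$; and for suitable coefficients $b_m,c_{m,k},d\in\mathbb C$ the following relations form a defining set with at most $(2n)^2-1$ elements: - $(\mathrm{ad}\,D)^{2n}S=b_1S$ and $[S,T_{2n-1}^1]=c_{2n-1,1}D$; - $(\mathrm{ad}\,D)^{2n}T_m^1=b_mT_m^1$ for $3\le m\le 2n-1$; - $T_{2n}^n=0$; and $[D,T_{2n}^k]=0$ and $[S,T_{2n}^k]=c_{2n,k}T_1^k$ for $2\le k\le 2n-1$, $k\neq n$; - $[S,T_1^k]=c_{1,k}T_2^k$ for $3\le k\le 2n-1$, and $[S,T_m^k]=c_{m,k}T_{m+1}^k$ for $2\le m\le 2n-2$, $2\le k\le 2n$; - $[S,S]=d\,T_2^{2n}$; - the relations from the identity element,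 $[D,T_{2n}^{2n}]=[S,T_{2n}^{2n}]=0$; - the relation between the two paths to $T_2^2$, $[S,T_1^2]=c_{1,2}T_2^2$. -/

import Mathlib

/-! ### Lie superalgebras over `ℂ` -/

/-- The sign `(-1)^{kl}` attached to two parities `k, l ∈ ℤ/2`. -/
noncomputable def superSign (k l : ZMod 2) : ℂ := (-1) ^ (k.val * l.val)

/-- The structure of a complex Lie superalgebra on a vector space `L`: a decomposition into an even
part `part 0` and an odd part `part 1`, and a bilinear superbracket that is graded,
super-skew-symmetric and satisfies the super Jacobi identity on homogeneous elements. -/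
structure LieSuperalgebra (L : Type*) [AddCommGroup L] [Module ℂ L] where
  part : ZMod 2 → Submodule ℂ L
  isCompl : IsCompl (part 0) (part 1)
  bracket : L →ₗ[ℂ] L →ₗ[ℂ] L
  bracket_mem : ∀ {k l : ZMod 2} {x y : L}, x ∈ part k → y ∈ part l → bracket x y ∈ part (k + l)
  skew : ∀ {k l : ZMod 2} {x y : L}, x ∈ part k → y ∈ part l →
    bracket x y = -(superSign k l • bracket y x)
  jacobi : ∀ {k l m : ZMod 2} {x y z : L}, x ∈ part k → y ∈ part l → z ∈ part m →
    bracket x (bracket y z) = bracket (bracket x y) z + superSign k l • bracket y (bracket x z)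

/-- Morphisms of Lie superalgebras: parity preserving linear maps compatible with the brackets. -/
structure LieSuperalgebra.Hom {L M : Type*} [AddCommGroup L] [Module ℂ L] [AddCommGroup M]
    [Module ℂ M] (G : LieSuperalgebra L) (H : LieSuperalgebra M) where
  toLinearMap : L →ₗ[ℂ] M
  map_part : ∀ {k : ZMod 2} {x : L}, x ∈ G.part k → toLinearMap x ∈ H.part k
  map_bracket : ∀ x y : L, toLinearMap (G.bracket x y) = H.bracket (toLinearMap x) (toLinearMap y)

/-- The two-sided ideal generated by a set of elements. -/
def LieSuperalgebra.idealSpan {L : Type*} [AddCommGroup L] [Module ℂ L] (G : LieSuperalgebra L)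
    (s : Set L) : Submodule ℂ L :=
  sInf {I | s ⊆ I ∧ ∀ x, ∀ y ∈ I, G.bracket x y ∈ I ∧ G.bracket y x ∈ I}

/-- An element is homogeneous if it is even or odd. -/
def LieSuperalgebra.IsHomogeneous {L : Type*} [AddCommGroup L] [Module ℂ L]
    (G : LieSuperalgebra L) (x : L) : Prop :=
  ∃ k, x ∈ G.part k

/-! ### The free Lie superalgebra on a set of generators with parities -/

section Free

variable {X : Type*}

/-- The parity automorphism of the free nonassociative algebra on the generators `X` of parities
`p`: it multiplies a word in the generators by `1` or `-1`, according to whether the number of odd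
letters is even or odd. -/
noncomputable def parityAut (p : X → ZMod 2) :
    FreeNonUnitalNonAssocAlgebra ℂ X →ₙₐ[ℂ] FreeNonUnitalNonAssocAlgebra ℂ X :=
  FreeNonUnitalNonAssocAlgebra.lift ℂ
    (fun x => ((-1 : ℂ) ^ (p x).val) • FreeNonUnitalNonAssocAlgebra.of ℂ x)

/-- The even and the odd part of the free nonassociative superalgebra: the linear combinations of
words with an even, respectively odd, number of odd letters. -/
noncomputable def wordPart (p : X → ZMod 2) (k : ZMod 2) :
    Submodule ℂ (FreeNonUnitalNonAssocAlgebra ℂ X) where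
  carrier := {w | parityAut p w = ((-1 : ℂ) ^ k.val) • w}
  add_mem' := by
    intro a b ha hb
    simp only [Set.mem_ofPred_eq] at *
    rw [map_add, ha, hb, smul_add]
  zero_mem' := by simp
  smul_mem' := by
    intro c a ha
    simp only [Set.mem_ofPred_eq] at *
    rw [map_smul, ha, smul_comm]

/-- The super-skew-symmetry and super Jacobi expressions in homogeneous elements of the free
nonassociative superalgebra. -/
inductive IsSuperIdentity (p : X → ZMod 2) : FreeNonUnitalNonAssocAlgebra ℂ X → Prop
  | skew {k l : ZMod 2} {x y : FreeNonUnitalNonAssocAlgebra ℂ X} :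
      x ∈ wordPart p k → y ∈ wordPart p l → IsSuperIdentity p (x * y + superSign k l • (y * x))
  | jacobi {k l m : ZMod 2} {x y z : FreeNonUnitalNonAssocAlgebra ℂ X} :
      x ∈ wordPart p k → y ∈ wordPart p l → z ∈ wordPart p m →
      IsSuperIdentity p (x * (y * z) - (x * y) * z - superSign k l • (y * (x * z)))

/-- The submodules that are two-sided ideals and contain all the super identities. -/
def IsIdentityIdeal (p : X → ZMod 2) (I : Submodule ℂ (FreeNonUnitalNonAssocAlgebra ℂ X)) : Prop :=
  (∀ w, IsSuperIdentity p w → w ∈ I) ∧ ∀ x, ∀ y ∈ I, x * y ∈ I ∧ y * x ∈ I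

/-- The two-sided ideal generated by the super identities. -/
noncomputable def identityIdeal (p : X → ZMod 2) : Submodule ℂ (FreeNonUnitalNonAssocAlgebra ℂ X) :=
  sInf {I | IsIdentityIdeal p I}

theorem identityIdeal_isIdentityIdeal (p : X → ZMod 2) : IsIdentityIdeal p (identityIdeal p) := by
  refine ⟨fun w hw => ?_, fun x y hy => ⟨?_, ?_⟩⟩
  · exact Submodule.mem_sInf.2 fun I hI => hI.1 w hw
  · exact Submodule.mem_sInf.2 fun I hI => (hI.2 x y (Submodule.mem_sInf.1 hy I hI)).1
  · exact Submodule.mem_sInf.2 fun I hI => (hI.2 x y (Submodule.mem_sInf.1 hy I hI)).2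

theorem identityIdeal_le {p : X → ZMod 2} {I : Submodule ℂ (FreeNonUnitalNonAssocAlgebra ℂ X)}
    (hI : IsIdentityIdeal p I) : identityIdeal p ≤ I := sInf_le hI

theorem neg_one_pow_val_add (k l : ZMod 2) :
    ((-1 : ℂ) ^ (k + l).val) = (-1) ^ k.val * (-1) ^ l.val := by
  rw [← pow_add, ZMod.val_add]
  exact (neg_one_pow_eq_pow_mod_two _).symm

theorem neg_one_pow_val_mul_self (k : ZMod 2) : ((-1 : ℂ) ^ k.val) * (-1) ^ k.val = 1 := by
  rw [← pow_add, Even.neg_one_pow ⟨_, rfl⟩]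

theorem parityAut_parityAut (p : X → ZMod 2) (w : FreeNonUnitalNonAssocAlgebra ℂ X) :
    parityAut p (parityAut p w) = w := by
  have h : (parityAut p).comp (parityAut p) = NonUnitalAlgHom.id ℂ _ := by
    apply FreeNonUnitalNonAssocAlgebra.hom_ext
    intro x
    simp [parityAut, smul_smul, neg_one_pow_val_mul_self]
  exact DFunLike.congr_fun h w

theorem mul_mem_wordPart {p : X → ZMod 2} {k l : ZMod 2}
    {x y : FreeNonUnitalNonAssocAlgebra ℂ X}
    (hx : x ∈ wordPart p k) (hy : y ∈ wordPart p l) : x * y ∈ wordPart p (k + l) := by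
  change parityAut p x = _ at hx
  change parityAut p y = _ at hy
  change parityAut p (x * y) = _
  rw [map_mul, hx, hy, smul_mul_smul_comm, neg_one_pow_val_add]

theorem wordPart_sup (p : X → ZMod 2) : wordPart p 0 ⊔ wordPart p 1 = ⊤ := by
  rw [eq_top_iff]
  intro w _
  have e : w = (2⁻¹ : ℂ) • (w + parityAut p w) + (2⁻¹ : ℂ) • (w - parityAut p w) := by
    rw [← smul_add, add_add_sub_cancel, ← two_smul ℂ w, smul_smul]; norm_num
  rw [e]
  refine Submodule.add_mem_sup (Submodule.smul_mem _ _ ?_) (Submodule.smul_mem _ _ ?_)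
  · change parityAut p _ = _
    rw [map_add, parityAut_parityAut]
    simp [add_comm]
  · change parityAut p _ = _
    rw [map_sub, parityAut_parityAut]
    simp [ZMod.val_one]

/-- The parity automorphism as a linear map. -/
noncomputable def parityLin (p : X → ZMod 2) :
    FreeNonUnitalNonAssocAlgebra ℂ X →ₗ[ℂ] FreeNonUnitalNonAssocAlgebra ℂ X where
  toFun := parityAut p
  map_add' := map_add _
  map_smul' := fun c x => map_smul _ c x

theorem identityIdeal_le_comap (p : X → ZMod 2) :
    identityIdeal p ≤ (identityIdeal p).comap (parityLin p) := by
  apply identityIdeal_le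
  have hI := identityIdeal_isIdentityIdeal p
  refine ⟨fun w hw => ?_, fun x y hy => ⟨?_, ?_⟩⟩
  · change parityAut p w ∈ identityIdeal p
    cases hw with
    | @skew k l x y hx hy =>
      have : parityAut p (x * y + superSign k l • (y * x)) =
          ((-1 : ℂ) ^ (k + l).val) • (x * y + superSign k l • (y * x)) := by
        have h1 : parityAut p (x * y) = _ := mul_mem_wordPart hx hy
        have h2 : parityAut p (y * x) = _ := mul_mem_wordPart hy hx
        rw [map_add, map_smul, h1, h2, smul_add, add_comm l k, smul_comm (superSign k l)]
      rw [this]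
      exact Submodule.smul_mem _ _ (hI.1 _ (.skew hx hy))
    | @jacobi k l m x y z hx hy hz =>
      have : parityAut p (x * (y * z) - (x * y) * z - superSign k l • (y * (x * z))) =
          ((-1 : ℂ) ^ (k + l + m).val) •
            (x * (y * z) - (x * y) * z - superSign k l • (y * (x * z))) := by
        have h1 : parityAut p (x * (y * z)) = _ :=
          mul_mem_wordPart hx (mul_mem_wordPart hy hz)
        have h2 : parityAut p ((x * y) * z) = _ :=
          mul_mem_wordPart (mul_mem_wordPart hx hy) hz
        have h3 : parityAut p (y * (x * z)) = _ :=
          mul_mem_wordPart hy (mul_mem_wordPart hx hz)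
        rw [map_sub, map_sub, map_smul, h1, h2, h3, smul_sub, smul_sub,
          smul_comm (superSign k l), ← add_assoc, ← add_assoc, add_comm l k]
      rw [this]
      exact Submodule.smul_mem _ _ (hI.1 _ (.jacobi hx hy hz))
  · change parityAut p (x * y) ∈ identityIdeal p
    rw [map_mul]
    exact (hI.2 _ _ hy).1
  · change parityAut p (y * x) ∈ identityIdeal p
    rw [map_mul]
    exact (hI.2 _ _ hy).2

/-- The underlying vector space of the free Lie superalgebra on generators `X` of parities `p`. -/
abbrev FreeLieSuper (p : X → ZMod 2) : Type _ :=
  FreeNonUnitalNonAssocAlgebra ℂ X ⧸ identityIdeal p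

/-- The bracket of the free Lie superalgebra, induced by the product of words. -/
noncomputable def freeBracket (p : X → ZMod 2) :
    FreeLieSuper p →ₗ[ℂ] FreeLieSuper p →ₗ[ℂ] FreeLieSuper p :=
  (identityIdeal p).liftQ
    { toFun := fun a => (identityIdeal p).liftQ
        ((identityIdeal p).mkQ.comp (LinearMap.mul ℂ (FreeNonUnitalNonAssocAlgebra ℂ X) a))
        (fun y hy => by
          rw [LinearMap.mem_ker, LinearMap.comp_apply, Submodule.mkQ_apply,
            Submodule.Quotient.mk_eq_zero]
          exact ((identityIdeal_isIdentityIdeal p).2 a y hy).1)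
      map_add' := fun a b => by
        ext y
        simp
      map_smul' := fun c a => by
        ext y
        simp }
    (fun x hx => by
      rw [LinearMap.mem_ker]
      apply Submodule.linearMap_qext
      apply LinearMap.ext
      intro y
      change (Submodule.Quotient.mk (x * y) : FreeLieSuper p) = 0
      rw [Submodule.Quotient.mk_eq_zero]
      exact ((identityIdeal_isIdentityIdeal p).2 y x hx).2)

theorem freeBracket_mk (p : X → ZMod 2) (x y : FreeNonUnitalNonAssocAlgebra ℂ X) :
    freeBracket p ((identityIdeal p).mkQ x) ((identityIdeal p).mkQ y) =
      (identityIdeal p).mkQ (x * y) := rfl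

/-- The free Lie superalgebra on generators `X` of parities `p`: the quotient of the free
nonassociative superalgebra by the ideal of super identities. -/
noncomputable def freeLieSuperalgebra (p : X → ZMod 2) : LieSuperalgebra (FreeLieSuper p) where
  part k := (wordPart p k).map (identityIdeal p).mkQ
  isCompl := by
    constructor
    · rw [Submodule.disjoint_def]
      rintro _ ⟨x, hx, rfl⟩ ⟨y, hy, hxy⟩
      have key := (Submodule.Quotient.eq _).1 hxy
      have hm : parityAut p (y - x) ∈ identityIdeal p := identityIdeal_le_comap p key
      change parityAut p x = _ at hx
      change parityAut p y = _ at hy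
      rw [map_sub, hx, hy] at hm
      have h2 := Submodule.add_mem _ key hm
      have e : y - x + (((-1 : ℂ) ^ (1 : ZMod 2).val) • y - ((-1 : ℂ) ^ (0 : ZMod 2).val) • x)
          = (-2 : ℂ) • x := by
        simp only [ZMod.val_one, ZMod.val_zero, pow_one, pow_zero, neg_smul, one_smul, two_smul]
        abel
      rw [e] at h2
      have h3 := Submodule.smul_mem _ (-2 : ℂ)⁻¹ h2
      rw [smul_smul, inv_mul_cancel₀ (by norm_num), one_smul] at h3
      exact (Submodule.Quotient.mk_eq_zero _).2 h3
    · rw [codisjoint_iff, ← Submodule.map_sup, wordPart_sup, Submodule.map_top,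
        Submodule.range_mkQ]
  bracket := freeBracket p
  bracket_mem := by
    rintro k l _ _ ⟨x, hx, rfl⟩ ⟨y, hy, rfl⟩
    exact ⟨x * y, mul_mem_wordPart hx hy, rfl⟩
  skew := by
    rintro k l _ _ ⟨x, hx, rfl⟩ ⟨y, hy, rfl⟩
    rw [freeBracket_mk, freeBracket_mk, eq_neg_iff_add_eq_zero, ← map_smul, ← map_add]
    exact (Submodule.Quotient.mk_eq_zero _).2
      ((identityIdeal_isIdentityIdeal p).1 _ (.skew hx hy))
  jacobi := by
    rintro k l m _ _ _ ⟨x, hx, rfl⟩ ⟨y, hy, rfl⟩ ⟨z, hz, rfl⟩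
    simp only [freeBracket_mk]
    rw [← sub_eq_zero, ← sub_sub, ← map_smul, ← map_sub, ← map_sub]
    exact (Submodule.Quotient.mk_eq_zero _).2
      ((identityIdeal_isIdentityIdeal p).1 _ (.jacobi hx hy hz))

/-- A generator as an element of the free Lie superalgebra. -/
noncomputable def freeGen (p : X → ZMod 2) (x : X) : FreeLieSuper p :=
  (identityIdeal p).mkQ (FreeNonUnitalNonAssocAlgebra.of ℂ x)

variable {L : Type*} [AddCommGroup L] [Module ℂ L]

/-- The bracket of a Lie superalgebra regarded as a nonassociative product. -/
abbrev LieSuperalgebra.toRing (G : LieSuperalgebra L) : NonUnitalNonAssocRing L :=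
  { (inferInstance : AddCommGroup L) with
    mul := fun x y => G.bracket x y
    left_distrib := fun x y z => map_add (G.bracket x) y z
    right_distrib := fun x y z => LinearMap.map_add₂ G.bracket x y z
    zero_mul := fun x => LinearMap.map_zero₂ G.bracket x
    mul_zero := fun x => map_zero (G.bracket x) }

/-- The linear map on the free nonassociative algebra that extends a given assignment of the
generators and sends products of words to brackets. -/
noncomputable def LieSuperalgebra.wordLift (G : LieSuperalgebra L) (f : X → L) :
    FreeNonUnitalNonAssocAlgebra ℂ X →ₗ[ℂ] L :=
  let _ : NonUnitalNonAssocRing L := G.toRing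
  have _ : IsScalarTower ℂ L L := ⟨fun c x y => LinearMap.map_smul₂ G.bracket c x y⟩
  have _ : SMulCommClass ℂ L L := ⟨fun c x y => ((G.bracket x).map_smul c y).symm⟩
  let F : FreeNonUnitalNonAssocAlgebra ℂ X →ₙₐ[ℂ] L := FreeNonUnitalNonAssocAlgebra.lift ℂ f
  { toFun := F, map_add' := map_add F, map_smul' := fun c x => map_smul F c x }

theorem LieSuperalgebra.wordLift_of (G : LieSuperalgebra L) (f : X → L) (x : X) :
    G.wordLift f (FreeNonUnitalNonAssocAlgebra.of ℂ x) = f x := by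
  let _ : NonUnitalNonAssocRing L := G.toRing
  have _ : IsScalarTower ℂ L L := ⟨fun c x y => LinearMap.map_smul₂ G.bracket c x y⟩
  have _ : SMulCommClass ℂ L L := ⟨fun c x y => ((G.bracket x).map_smul c y).symm⟩
  exact FreeNonUnitalNonAssocAlgebra.lift_of_apply ℂ f x

theorem LieSuperalgebra.wordLift_mul (G : LieSuperalgebra L) (f : X → L)
    (x y : FreeNonUnitalNonAssocAlgebra ℂ X) :
    G.wordLift f (x * y) = G.bracket (G.wordLift f x) (G.wordLift f y) := by
  let _ : NonUnitalNonAssocRing L := G.toRing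
  have _ : IsScalarTower ℂ L L := ⟨fun c x y => LinearMap.map_smul₂ G.bracket c x y⟩
  have _ : SMulCommClass ℂ L L := ⟨fun c x y => ((G.bracket x).map_smul c y).symm⟩
  let F : FreeNonUnitalNonAssocAlgebra ℂ X →ₙₐ[ℂ] L := FreeNonUnitalNonAssocAlgebra.lift ℂ f
  exact map_mul F x y

/-- Every element is the sum of an even and an odd element. -/
theorem LieSuperalgebra.exists_add (G : LieSuperalgebra L) (x : L) :
    ∃ y ∈ G.part 0, ∃ z ∈ G.part 1, y + z = x :=
  Submodule.mem_sup.1 (G.isCompl.sup_eq_top ▸ Submodule.mem_top)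

/-- The parity automorphism of a Lie superalgebra. -/
theorem LieSuperalgebra.exists_parity (G : LieSuperalgebra L) :
    ∃ θ : L →ₗ[ℂ] L, (∀ k : ZMod 2, ∀ x ∈ G.part k, θ x = ((-1 : ℂ) ^ k.val) • x) ∧
      (∀ x y, θ (G.bracket x y) = G.bracket (θ x) (θ y)) ∧
      ∀ k : ZMod 2, ∀ x, θ x = ((-1 : ℂ) ^ k.val) • x → x ∈ G.part k := by
  let θ : L →ₗ[ℂ] L := LinearMap.ofIsCompl G.isCompl (G.part 0).subtype (-(G.part 1).subtype)
  have h0 : ∀ x ∈ G.part 0, θ x = x := fun x hx =>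
    LinearMap.ofIsCompl_apply_left G.isCompl ⟨x, hx⟩
  have h1 : ∀ x ∈ G.part 1, θ x = -x := fun x hx =>
    LinearMap.ofIsCompl_apply_right G.isCompl ⟨x, hx⟩
  have hk : ∀ k : ZMod 2, ∀ x ∈ G.part k, θ x = ((-1 : ℂ) ^ k.val) • x := by
    intro k x hx
    have hk : k = 0 ∨ k = 1 := by clear * -; revert k; decide
    rcases hk with rfl | rfl
    · simpa using h0 x hx
    · simpa [ZMod.val_one] using h1 x hx
  refine ⟨θ, hk, fun x y => ?_, fun k x hx => ?_⟩
  · have hom : ∀ k l : ZMod 2, ∀ x ∈ G.part k, ∀ y ∈ G.part l,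
        θ (G.bracket x y) = G.bracket (θ x) (θ y) := by
      intro k l x hx y hy
      rw [hk _ _ (G.bracket_mem hx hy), hk _ _ hx, hk _ _ hy, neg_one_pow_val_add, map_smul,
        LinearMap.map_smul₂, smul_smul, mul_comm]
    obtain ⟨x0, hx0, x1, hx1, rfl⟩ := G.exists_add x
    obtain ⟨y0, hy0, y1, hy1, rfl⟩ := G.exists_add y
    simp only [map_add, LinearMap.add_apply, hom _ _ _ hx0 _ hy0, hom _ _ _ hx0 _ hy1,
      hom _ _ _ hx1 _ hy0, hom _ _ _ hx1 _ hy1]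
  · obtain ⟨x0, hx0, x1, hx1, rfl⟩ := G.exists_add x
    rw [map_add, h0 _ hx0, h1 _ hx1] at hx
    have hk : k = 0 ∨ k = 1 := by clear * -; revert k; decide
    rcases hk with rfl | rfl
    · have h : (2 : ℂ) • x1 = 0 := by
        rw [two_smul]
        simp only [ZMod.val_zero, pow_zero, one_smul] at hx
        have := add_left_cancel hx
        nth_rewrite 1 [← this]
        simp
      have := (smul_eq_zero.1 h).resolve_left two_ne_zero
      simpa [this] using hx0
    · have h : (2 : ℂ) • x0 = 0 := by
        rw [two_smul]
        simp only [ZMod.val_one, pow_one, neg_smul, one_smul, neg_add] at hx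
        have := add_right_cancel hx
        nth_rewrite 1 [this]
        simp
      have := (smul_eq_zero.1 h).resolve_left two_ne_zero
      simpa [this] using hx1

theorem LieSuperalgebra.wordLift_mem (G : LieSuperalgebra L) {p : X → ZMod 2} {f : X → L}
    (hf : ∀ x, f x ∈ G.part (p x)) {k : ZMod 2} {w : FreeNonUnitalNonAssocAlgebra ℂ X}
    (hw : w ∈ wordPart p k) : G.wordLift f w ∈ G.part k := by
  obtain ⟨θ, hθ, hbr, hmem⟩ := G.exists_parity
  apply hmem
  have comm : ∀ w, G.wordLift f (parityAut p w) = θ (G.wordLift f w) := by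
    let _ : NonUnitalNonAssocRing L := G.toRing
    have _ : IsScalarTower ℂ L L := ⟨fun c x y => LinearMap.map_smul₂ G.bracket c x y⟩
    have _ : SMulCommClass ℂ L L := ⟨fun c x y => ((G.bracket x).map_smul c y).symm⟩
    let F₁ : FreeNonUnitalNonAssocAlgebra ℂ X →ₙₐ[ℂ] L :=
      { toFun := fun w => G.wordLift f (parityAut p w)
        map_smul' := fun c x => by simp
        map_zero' := by simp
        map_add' := fun x y => by simp
        map_mul' := fun x y => by rw [map_mul, G.wordLift_mul]; rfl }
    let F₂ : FreeNonUnitalNonAssocAlgebra ℂ X →ₙₐ[ℂ] L :=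
      { toFun := fun w => θ (G.wordLift f w)
        map_smul' := fun c x => by simp
        map_zero' := by simp
        map_add' := fun x y => by simp
        map_mul' := fun x y => by rw [G.wordLift_mul, hbr]; rfl }
    have h : F₁ = F₂ := by
      apply FreeNonUnitalNonAssocAlgebra.hom_ext
      intro x
      change G.wordLift f (parityAut p _) = θ (G.wordLift f _)
      rw [G.wordLift_of, hθ _ _ (hf x), parityAut, FreeNonUnitalNonAssocAlgebra.lift_of_apply,
        map_smul, G.wordLift_of]
    intro w
    exact DFunLike.congr_fun h w
  rw [← comm]
  change parityAut p w = _ at hw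
  rw [hw, map_smul]

/-- The morphism from the free Lie superalgebra to a Lie superalgebra given by a parity preserving
assignment of the generators. -/
noncomputable def LieSuperalgebra.lift (G : LieSuperalgebra L) (p : X → ZMod 2) (f : X → L)
    (hf : ∀ x, f x ∈ G.part (p x)) : LieSuperalgebra.Hom (freeLieSuperalgebra p) G where
  toLinearMap := (identityIdeal p).liftQ (G.wordLift f) (by
    apply identityIdeal_le
    refine ⟨fun w hw => ?_, fun x y hy => ?_⟩
    · rw [LinearMap.mem_ker]
      cases hw with
      | skew hx hy =>
        rw [map_add, map_smul, G.wordLift_mul, G.wordLift_mul,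
          G.skew (G.wordLift_mem hf hx) (G.wordLift_mem hf hy), neg_add_cancel]
      | jacobi hx hy hz =>
        simp only [map_sub, map_smul, G.wordLift_mul]
        rw [G.jacobi (G.wordLift_mem hf hx) (G.wordLift_mem hf hy) (G.wordLift_mem hf hz)]
        abel
    · rw [LinearMap.mem_ker] at hy
      simp [LinearMap.mem_ker, G.wordLift_mul, hy])
  map_part := by
    rintro k _ ⟨x, hx, rfl⟩
    exact G.wordLift_mem hf hx
  map_bracket := by
    intro x y
    obtain ⟨x, rfl⟩ := Submodule.mkQ_surjective _ x
    obtain ⟨y, rfl⟩ := Submodule.mkQ_surjective _ y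
    exact G.wordLift_mul f x y

theorem LieSuperalgebra.lift_freeGen (G : LieSuperalgebra L) (p : X → ZMod 2) (f : X → L)
    (hf : ∀ x, f x ∈ G.part (p x)) (x : X) :
    (G.lift p f hf).toLinearMap (freeGen p x) = f x :=
  G.wordLift_of f x

end Free

/-! ### General linear and special linear Lie superalgebras of matrices -/

section Matrices

variable {ι : Type*}

/-- Matrices of parity `k` with respect to the row and column parities `p`: the entry in position
`(i, j)` vanishes unless `p i + p j = k`. -/
def matrixPart (p : ι → ZMod 2) (k : ZMod 2) : Submodule ℂ (Matrix ι ι ℂ) where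
  carrier := {A | ∀ i j, p i + p j ≠ k → A i j = 0}
  add_mem' := by
    intro A B hA hB i j h
    simp [hA i j h, hB i j h]
  zero_mem' := by simp
  smul_mem' := by
    intro c A hA i j h
    simp [hA i j h]

/-- The component of parity `k` of a matrix. -/
def matrixComponent (p : ι → ZMod 2) (k : ZMod 2) : Matrix ι ι ℂ →ₗ[ℂ] Matrix ι ι ℂ where
  toFun A := Matrix.of fun i j => if p i + p j = k then A i j else 0
  map_add' A B := by
    ext i j
    by_cases h : p i + p j = k <;> simp [h]
  map_smul' c A := by
    ext i j
    simp

theorem matrixComponent_mem (p : ι → ZMod 2) (k : ZMod 2) (A : Matrix ι ι ℂ) :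
    matrixComponent p k A ∈ matrixPart p k := by
  intro i j h
  simp [matrixComponent, h]

theorem matrixComponent_of_mem {p : ι → ZMod 2} {k : ZMod 2} {A : Matrix ι ι ℂ}
    (hA : A ∈ matrixPart p k) (l : ZMod 2) :
    matrixComponent p l A = if k = l then A else 0 := by
  ext i j
  by_cases h : p i + p j = k
  · by_cases hl : k = l <;> simp [matrixComponent, h, hl]
  · by_cases hl : k = l <;> simp [matrixComponent, hA i j h, hl]

variable [Fintype ι]

theorem matrixPart_mul {p : ι → ZMod 2} {k l : ZMod 2} {A B : Matrix ι ι ℂ}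
    (hA : A ∈ matrixPart p k) (hB : B ∈ matrixPart p l) : A * B ∈ matrixPart p (k + l) := by
  intro i j h
  rw [Matrix.mul_apply]
  apply Finset.sum_eq_zero
  intro m _
  by_cases h1 : p i + p m = k
  · by_cases h2 : p m + p j = l
    · exfalso
      apply h
      rw [← h1, ← h2]
      generalize p i = a
      generalize p m = b
      generalize p j = c
      revert a b c
      decide
    · rw [hB m j h2, mul_zero]
  · rw [hA i m h1, zero_mul]

/-- The superbracket of matrices: `AB - (-1)^{kl} BA` for `A` of parity `k` and `B` of parity `l`,
extended bilinearly. -/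
noncomputable def matrixSuperbracket (p : ι → ZMod 2) :
    Matrix ι ι ℂ →ₗ[ℂ] Matrix ι ι ℂ →ₗ[ℂ] Matrix ι ι ℂ :=
  LinearMap.mk₂ ℂ
    (fun A B => ∑ k : ZMod 2, ∑ l : ZMod 2,
      (matrixComponent p k A * matrixComponent p l B -
        superSign k l • (matrixComponent p l B * matrixComponent p k A)))
    (fun A A' B => by
      simp only [map_add, add_mul, mul_add, smul_add, ← Finset.sum_add_distrib]
      refine Finset.sum_congr rfl fun k _ => Finset.sum_congr rfl fun l _ => ?_
      abel)
    (fun c A B => by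
      simp only [map_smul, smul_mul_assoc, mul_smul_comm, Finset.smul_sum, smul_sub]
      refine Finset.sum_congr rfl fun k _ => Finset.sum_congr rfl fun l _ => ?_
      rw [smul_comm c])
    (fun A B B' => by
      simp only [map_add, add_mul, mul_add, smul_add, ← Finset.sum_add_distrib]
      refine Finset.sum_congr rfl fun k _ => Finset.sum_congr rfl fun l _ => ?_
      abel)
    (fun c A B => by
      simp only [map_smul, smul_mul_assoc, mul_smul_comm, Finset.smul_sum, smul_sub]
      refine Finset.sum_congr rfl fun k _ => Finset.sum_congr rfl fun l _ => ?_
      rw [smul_comm c])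

theorem matrixSuperbracket_apply {p : ι → ZMod 2} {k l : ZMod 2} {A B : Matrix ι ι ℂ}
    (hA : A ∈ matrixPart p k) (hB : B ∈ matrixPart p l) :
    matrixSuperbracket p A B = A * B - superSign k l • (B * A) := by
  rw [matrixSuperbracket, LinearMap.mk₂_apply]
  simp only [matrixComponent_of_mem hA, matrixComponent_of_mem hB]
  rw [Finset.sum_eq_single k, Finset.sum_eq_single l]
  · simp
  · intro b _ hb
    simp [hb.symm]
  · simp
  · intro b _ hb
    simp [hb.symm]
  · simp

theorem superSign_comm (k l : ZMod 2) : superSign k l = superSign l k := by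
  rw [superSign, superSign, mul_comm]

theorem superSign_mul_self (k l : ZMod 2) : superSign k l * superSign k l = 1 := by
  rw [superSign, ← pow_add, Even.neg_one_pow ⟨_, rfl⟩]

theorem superSign_add_left (k l m : ZMod 2) :
    superSign (k + l) m = superSign k m * superSign l m := by
  rw [superSign, pow_mul, neg_one_pow_val_add, mul_pow, ← pow_mul, ← pow_mul]
  rfl

/-- The general linear Lie superalgebra of matrices with row and column parities `p`. -/
noncomputable def glSuper (p : ι → ZMod 2) : LieSuperalgebra (Matrix ι ι ℂ) where
  part := matrixPart p
  isCompl := by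
    constructor
    · rw [Submodule.disjoint_def]
      intro A h0 h1
      ext i j
      by_cases h : p i + p j = 0
      · exact h1 i j (by rw [h]; decide)
      · exact h0 i j h
    · rw [codisjoint_iff, eq_top_iff]
      intro A _
      have e : A = matrixComponent p 0 A + matrixComponent p 1 A := by
        ext i j
        have hk : p i + p j = 0 ∨ p i + p j = 1 := by
          generalize p i + p j = k
          revert k
          decide
        rcases hk with h | h <;> simp [matrixComponent, h]
      rw [e]
      exact Submodule.add_mem_sup (matrixComponent_mem p 0 A) (matrixComponent_mem p 1 A)
  bracket := matrixSuperbracket p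
  bracket_mem := by
    intro k l A B hA hB
    rw [matrixSuperbracket_apply hA hB]
    refine Submodule.sub_mem _ (matrixPart_mul hA hB) (Submodule.smul_mem _ _ ?_)
    rw [add_comm]
    exact matrixPart_mul hB hA
  skew := by
    intro k l A B hA hB
    rw [matrixSuperbracket_apply hA hB, matrixSuperbracket_apply hB hA, superSign_comm l k,
      smul_sub, smul_smul, superSign_mul_self, one_smul, neg_sub]
  jacobi := by
    intro k l m A B C hA hB hC
    have mem : ∀ {k l : ZMod 2} {A B : Matrix ι ι ℂ}, A ∈ matrixPart p k → B ∈ matrixPart p l →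
        matrixSuperbracket p A B ∈ matrixPart p (k + l) := by
      intro k l A B hA hB
      rw [matrixSuperbracket_apply hA hB]
      refine Submodule.sub_mem _ (matrixPart_mul hA hB) (Submodule.smul_mem _ _ ?_)
      rw [add_comm]
      exact matrixPart_mul hB hA
    rw [matrixSuperbracket_apply hA (mem hB hC), matrixSuperbracket_apply (mem hA hB) hC,
      matrixSuperbracket_apply hB (mem hA hC), matrixSuperbracket_apply hB hC,
      matrixSuperbracket_apply hA hB, matrixSuperbracket_apply hA hC,
      superSign_comm k (l + m), superSign_comm l (k + m), superSign_add_left, superSign_add_left,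
      superSign_add_left, superSign_comm m k, superSign_comm m l, superSign_comm l k]
    have h1 := superSign_mul_self k l
    simp only [mul_sub, sub_mul, smul_sub, smul_smul, mul_smul_comm, smul_mul_assoc, mul_assoc]
    have e : superSign k l * (superSign k l * superSign l m) = superSign l m := by
      rw [← mul_assoc, h1, one_mul]
    have e2 : superSign k l * (superSign k l * (superSign l m * superSign k m)) =
        superSign k m * superSign l m := by
      rw [← mul_assoc, h1, one_mul, mul_comm]
    have e3 : superSign k l * (superSign k m * superSign l m) =
        superSign k m * (superSign l m * superSign k l) := by ring
    rw [e, e2, e3]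
    abel

/-- The supertrace. -/
def supertrace (p : ι → ZMod 2) : Matrix ι ι ℂ →ₗ[ℂ] ℂ where
  toFun A := ∑ i, (-1 : ℂ) ^ (p i).val * A i i
  map_add' A B := by simp [mul_add, Finset.sum_add_distrib]
  map_smul' c A := by
    simp only [Matrix.smul_apply, smul_eq_mul, Finset.mul_sum, RingHom.id_apply]
    exact Finset.sum_congr rfl fun i _ => by ring

/-- The special linear Lie superalgebra, as a subspace of the matrices: the supertraceless
matrices. -/
def slSuper (p : ι → ZMod 2) : Submodule ℂ (Matrix ι ι ℂ) :=
  LinearMap.ker (supertrace p)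

end Matrices

/-! ### Sylvester's generators -/

/-- The two Sylvester generators `D` and `S`. -/
inductive SylvesterGen
  | D
  | S

/-- `D` is even and `S` is odd. -/
def sylvesterParity : SylvesterGen → ZMod 2
  | .D => 0
  | .S => 1

/-- The alternating format even, odd, even, odd, … on the `(n|n)`-dimensional superspace. -/
def alternating (n : ℕ) (i : Fin (2 * n)) : ZMod 2 := (i.val : ZMod 2)

/-- The matrices `D = diag(1, a, …, a^{2n-1})`, with `a = exp(2πi/(2n))`, and `S`, the cyclic shift
with the entry `1` in the positions `(i, i + 1)`, the indices being taken modulo `2n`. -/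
noncomputable def sylvesterMatrix (n : ℕ) : SylvesterGen → Matrix (Fin (2 * n)) (Fin (2 * n)) ℂ
  | .D => Matrix.diagonal fun i =>
      Complex.exp (2 * Real.pi * Complex.I / ((2 * n : ℕ) : ℂ)) ^ i.val
  | .S => Matrix.of fun i j => if j.val = (i.val + 1) % (2 * n) then 1 else 0

theorem sylvesterMatrix_mem (n : ℕ) (g : SylvesterGen) :
    sylvesterMatrix n g ∈ (glSuper (alternating n)).part (sylvesterParity g) := by
  cases g with
  | D =>
    intro i j h
    apply Matrix.diagonal_apply_ne
    rintro rfl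
    exact h (CharTwo.add_self_eq_zero _)
  | S =>
    intro i j h
    simp only [sylvesterMatrix, Matrix.of_apply]
    rw [if_neg]
    intro hj
    apply h
    have h2 : ((j.val : ℕ) : ZMod 2) = ((i.val + 1 : ℕ) : ZMod 2) := by
      rw [ZMod.natCast_eq_natCast_iff', hj, Nat.mod_mod_of_dvd _ (dvd_mul_right 2 n)]
    change (i.val : ZMod 2) + (j.val : ZMod 2) = 1
    rw [h2, Nat.cast_add, ← add_assoc, CharTwo.add_self_eq_zero, zero_add, Nat.cast_one]

/-- The free Lie superalgebra on the even generator `D` and the odd generator `S`. -/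
abbrev FreeSylvester : Type := FreeLieSuper sylvesterParity

/-- The evaluation of the elements of the free Lie superalgebra on `D` and `S` at Sylvester's
matrices. -/
noncomputable def sylvesterEval (n : ℕ) :
    LieSuperalgebra.Hom (freeLieSuperalgebra sylvesterParity) (glSuper (alternating n)) :=
  (glSuper (alternating n)).lift sylvesterParity (sylvesterMatrix n) (sylvesterMatrix_mem n)

/-- The Lie superalgebra generated by Sylvester's matrices. -/
noncomputable def sylvesterSpan (n : ℕ) : Submodule ℂ (Matrix (Fin (2 * n)) (Fin (2 * n)) ℂ) :=
  LinearMap.range (sylvesterEval n).toLinearMap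

/-- A set of homogeneous elements of the free Lie superalgebra on `D` and `S` is a defining set of
relations between Sylvester's generators if the ideal that it generates consists of exactly those
elements that vanish on Sylvester's matrices. -/
def IsDefiningSet (n : ℕ) (s : Set FreeSylvester) : Prop :=
  (∀ x ∈ s, (freeLieSuperalgebra sylvesterParity).IsHomogeneous x) ∧
    (freeLieSuperalgebra sylvesterParity).idealSpan s = LinearMap.ker (sylvesterEval n).toLinearMap

/-- The number `R(n)` of independent relations between Sylvester's generators: the least number of
elements of a defining set of relations. -/
noncomputable def relationNumber (n : ℕ) : ℕ∞ :=
  ⨅ (s : Set FreeSylvester) (_ : IsDefiningSet n s), s.encard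

/-- The generator `D` of the free Lie superalgebra. -/
noncomputable def genD : FreeSylvester := freeGen sylvesterParity .D

/-- The generator `S` of the free Lie superalgebra. -/
noncomputable def genS : FreeSylvester := freeGen sylvesterParity .S

/-- `ad D` on the free Lie superalgebra. -/
noncomputable def adD : FreeSylvester →ₗ[ℂ] FreeSylvester :=
  (freeLieSuperalgebra sylvesterParity).bracket genD

/-- `ad S` on the free Lie superalgebra. -/
noncomputable def adS : FreeSylvester →ₗ[ℂ] FreeSylvester :=
  (freeLieSuperalgebra sylvesterParity).bracket genS

/-- The four relations in the case `n = 1`: `[D,[D,S]] = 4S`, `[S,[D,S]] = 0`, `[D,[S,S]] = 0`,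
`[S,[S,S]] = 0`. -/
noncomputable def relationsOne : Set FreeSylvester :=
  {adD (adD genS) - (4 : ℂ) • genS, adS (adD genS), adD (adS genS), adS (adS genS)}

/-- The elements `T_m^k` for `1 ≤ k, m ≤ 2n`:
`T_m^k = (ad D)^{k-1} (ad S)^{m-1} [D,S]` for `m < 2n`, and `T_{2n}^k = [S, T_{2n-1}^k]`. -/
noncomputable def gridT (n m k : ℕ) : FreeSylvester :=
  if m = 2 * n then adS ((adD ^ (k - 1)) ((adS ^ (m - 2)) (adD genS)))
  else (adD ^ (k - 1)) ((adS ^ (m - 1)) (adD genS))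

/-- The relation between the two paths to `T_2^2`: `(ad S)(ad D)^2 S = c T_2^2`. -/
noncomputable def relationTwoTwo (n : ℕ) (c : ℂ) : FreeSylvester :=
  adS (gridT n 1 2) - c • gridT n 2 2

/-- The relations that express that the element `T_{2n}^{2n}`, which represents a multiple of the
identity matrix, commutes with `D` and `S`. -/
noncomputable def relationsIdentity (n : ℕ) : Set FreeSylvester :=
  {adD (gridT n (2 * n) (2 * n)), adS (gridT n (2 * n) (2 * n))}

/-- The other relations read off from the grid of the elements `T_m^k`, for given coefficients:
`b` of the relations that close up horizontally, `c m k` of the step from `T_m^k` downwards,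
and `d` of `[S,S] = d T_2^{2n}`. -/
noncomputable def relationsGrid (n : ℕ) (b : ℕ → ℂ) (c : ℕ → ℕ → ℂ) (d : ℂ) : Set FreeSylvester :=
  -- the `2n`-th powers of `ad D` and `ad S`
  {(adD ^ (2 * n)) genS - b 1 • genS, adS (gridT n (2 * n - 1) 1) - c (2 * n - 1) 1 • genD} ∪
  -- the powers of `ad D` in the rows `3, …, 2n - 1`; for row `2` this follows from `[S,S]`
  {x | ∃ m, 3 ≤ m ∧ m ≤ 2 * n - 1 ∧ x = (adD ^ (2 * n)) (gridT n m 1) - b m • gridT n m 1} ∪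
  -- the last row; its `n`-th element is zero and its other elements commute with `D`
  {gridT n (2 * n) n} ∪
  {x | ∃ k, 2 ≤ k ∧ k ≤ 2 * n - 1 ∧ k ≠ n ∧ x = adD (gridT n (2 * n) k)} ∪
  {x | ∃ k, 2 ≤ k ∧ k ≤ 2 * n - 1 ∧ k ≠ n ∧
    x = adS (gridT n (2 * n) k) - c (2 * n) k • gridT n 1 k} ∪
  -- the vertical steps from row `1` to row `2`, other than the one to `T_2^2`
  {x | ∃ k, 3 ≤ k ∧ k ≤ 2 * n - 1 ∧ x = adS (gridT n 1 k) - c 1 k • gridT n 2 k} ∪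
  -- the vertical steps from row `m` to row `m + 1`
  {x | ∃ m k, 2 ≤ m ∧ m + 2 ≤ 2 * n ∧ 2 ≤ k ∧ k ≤ 2 * n ∧
    x = adS (gridT n m k) - c m k • gridT n (m + 1) k} ∪
  -- the superbracket of `S` with itself
  {adS genS - d • gridT n 2 (2 * n)}

/-! Sylvester's matrices satisfy SD = aDS. The (2n)² monomials D^k S^m, with exponents modulo 2n,
therefore form a basis of all matrices on which the generators act as weighted shifts: [D, D^k S^m]
= (1 - a^m) D^{k+1} S^m and [S, D^k S^m] = (a^k - (-1)^m) D^k S^{m+1}. For n > 1 the weights met on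
the way to T_m^k are nonzero, except for the last one at T_{2n}^n. So T_m^k evaluates to a nonzero
multiple of D^k S^m, while T_{2n}^n evaluates to 0. The missing monomial D^n is the only one with
nonzero supertrace, hence the image is sl(n|n).

Let I be the ideal generated by the relations and V the sum of I and the span of the T_m^k.
`span_gridT_sup_idealSpan` shows that V contains D and S and is stable under ad D and ad S, and by
`freeLieSuper_eq_top` such a subspace is everything. An element of the kernel of the evaluation is
then a combination of the T_m^k plus an element of I. Independence of the monomials kills every
coefficient except that of T_{2n}^n, which is itself a relation
(`isDefiningSet_of_span_sup_eq_top`).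

The set is small because many stability conditions are free. Steps along the rows m < 2n, down
column 1 as far as row 2n - 1 and into row 2n hold by definition. Bracketing relations with D or S
closes row 1 and yields [S, T_1^{2n}] and the brackets with T_{2n}^1 and T_{2n}^n; the identity
[D,[S,S]] = 2[S,[D,S]] closes row 2.

For n = 1 the weight a + 1 vanishes and column 1 breaks off; the same argument runs with [D,S], D,
S, [S,S] in place of the grid. -/

/-! ### Ideals, and a spanning criterion for free Lie superalgebras -/

theorem LieSuperalgebra.subset_idealSpan {L : Type*} [AddCommGroup L] [Module ℂ L]
    (G : LieSuperalgebra L) (s : Set L) : s ⊆ G.idealSpan s :=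
  fun _ hx => Submodule.mem_sInf.2 fun _ hI => hI.1 hx

theorem LieSuperalgebra.bracket_mem_idealSpan {L : Type*} [AddCommGroup L] [Module ℂ L]
    (G : LieSuperalgebra L) (s : Set L) (x : L) {y : L} (hy : y ∈ G.idealSpan s) :
    G.bracket x y ∈ G.idealSpan s :=
  Submodule.mem_sInf.2 fun I hI => (hI.2 x y (Submodule.mem_sInf.1 hy I hI)).1

theorem LieSuperalgebra.Hom.idealSpan_le_ker {L M : Type*} [AddCommGroup L] [Module ℂ L]
    [AddCommGroup M] [Module ℂ M] {G : LieSuperalgebra L} {H : LieSuperalgebra M} (φ : G.Hom H)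
    {s : Set L} (hs : ∀ x ∈ s, φ.toLinearMap x = 0) :
    G.idealSpan s ≤ LinearMap.ker φ.toLinearMap := by
  refine sInf_le ⟨hs, fun x y hy => ?_⟩
  rw [LinearMap.mem_ker] at hy
  simp [LinearMap.mem_ker, φ.map_bracket, hy]

/-- The super Jacobi identity, with the third argument not necessarily homogeneous. -/
theorem LieSuperalgebra.bracket_bracket {L : Type*} [AddCommGroup L] [Module ℂ L]
    (G : LieSuperalgebra L) {k l : ZMod 2} {x y : L} (hx : x ∈ G.part k) (hy : y ∈ G.part l)
    (z : L) : G.bracket (G.bracket x y) z =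
      G.bracket x (G.bracket y z) - superSign k l • G.bracket y (G.bracket x z) := by
  obtain ⟨z₀, h₀, z₁, h₁, rfl⟩ := G.exists_add z
  simp only [map_add, smul_add, G.jacobi hx hy h₀, G.jacobi hx hy h₁]
  abel

/-- A magma word in the generators as an element of the free Lie superalgebra. -/
noncomputable def freeWord {X : Type*} (p : X → ZMod 2) (w : FreeMagma X) : FreeLieSuper p :=
  (identityIdeal p).mkQ (MonoidAlgebra.single w (1 : ℂ))

theorem freeWord_mul {X : Type*} (p : X → ZMod 2) (v w : FreeMagma X) :
    freeWord p (v * w) = (freeLieSuperalgebra p).bracket (freeWord p v) (freeWord p w) := by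
  change _ = freeBracket p _ _
  rw [freeWord, freeWord, freeWord, freeBracket_mk, MonoidAlgebra.single_mul_single, one_mul]

theorem freeGen_mem_part {X : Type*} (p : X → ZMod 2) (x : X) :
    freeGen p x ∈ (freeLieSuperalgebra p).part (p x) :=
  ⟨_, FreeNonUnitalNonAssocAlgebra.lift_of_apply ℂ _ x, rfl⟩

theorem exists_freeWord_mem_part {X : Type*} (p : X → ZMod 2) (w : FreeMagma X) :
    ∃ k, freeWord p w ∈ (freeLieSuperalgebra p).part k := by
  induction w with
  | ih1 x => exact ⟨p x, freeGen_mem_part p x⟩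
  | ih2 v w hv hw =>
    obtain ⟨k, hk⟩ := hv
    obtain ⟨l, hl⟩ := hw
    exact ⟨k + l, by
      rw [freeWord_mul]; exact (freeLieSuperalgebra p).bracket_mem hk hl⟩

/-- A subspace of the free Lie superalgebra that contains the generators and is stable under the
brackets with the generators is the whole space. -/
theorem freeLieSuper_eq_top {X : Type*} (p : X → ZMod 2) {V : Submodule ℂ (FreeLieSuper p)}
    (hgen : ∀ x, freeGen p x ∈ V)
    (had : ∀ x, ∀ v ∈ V, (freeLieSuperalgebra p).bracket (freeGen p x) v ∈ V) : V = ⊤ := by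
  -- Words are homogeneous, so by super Jacobi ad [v, w] is a combination of ad v ad w and ad w ad
  -- v; stability passes from the generators to all words.
  have key : ∀ w, ∀ v ∈ V, (freeLieSuperalgebra p).bracket (freeWord p w) v ∈ V := by
    intro w
    induction w with
    | ih1 x => exact had x
    | ih2 v w hv hw =>
      intro z hz
      obtain ⟨k, hk⟩ := exists_freeWord_mem_part p v
      obtain ⟨l, hl⟩ := exists_freeWord_mem_part p w
      rw [freeWord_mul, (freeLieSuperalgebra p).bracket_bracket hk hl]
      exact V.sub_mem (hv _ (hw _ hz)) (V.smul_mem _ (hw _ (hv _ hz)))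
  have words : ∀ w, freeWord p w ∈ V := by
    intro w
    induction w with
    | ih1 x => exact hgen x
    | ih2 v w hv hw =>
      rw [freeWord_mul]
      exact key v _ hw
  rw [eq_top_iff]
  intro x _
  obtain ⟨f, rfl⟩ := Submodule.mkQ_surjective _ x
  induction f using MonoidAlgebra.induction_linear with
  | zero => simp
  | add f g hf hg => rw [map_add]; exact V.add_mem (hf trivial) (hg trivial)
  | single w r =>
    have e : (MonoidAlgebra.single w r : FreeNonUnitalNonAssocAlgebra ℂ X) =
        r • MonoidAlgebra.single w (1 : ℂ) := by
      simp
    rw [e, map_smul]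
    exact V.smul_mem r (words w)

/-! ### A criterion for defining sets of relations -/

section Presentation

variable {n : ℕ} {s : Set FreeSylvester} {ι : Type*} {t : ι → FreeSylvester}

theorem span_sup_idealSpan_eq_top
    (hD : genD ∈ Submodule.span ℂ (Set.range t) ⊔ (freeLieSuperalgebra sylvesterParity).idealSpan s)
    (hS : genS ∈ Submodule.span ℂ (Set.range t) ⊔ (freeLieSuperalgebra sylvesterParity).idealSpan s)
    (hDt : ∀ i, adD (t i) ∈
      Submodule.span ℂ (Set.range t) ⊔ (freeLieSuperalgebra sylvesterParity).idealSpan s)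
    (hSt : ∀ i, adS (t i) ∈
      Submodule.span ℂ (Set.range t) ⊔ (freeLieSuperalgebra sylvesterParity).idealSpan s) :
    Submodule.span ℂ (Set.range t) ⊔ (freeLieSuperalgebra sylvesterParity).idealSpan s = ⊤ := by
  set I := (freeLieSuperalgebra sylvesterParity).idealSpan s
  set V := Submodule.span ℂ (Set.range t) ⊔ I with hV
  have stable : ∀ g : FreeSylvester,
      (∀ i, (freeLieSuperalgebra sylvesterParity).bracket g (t i) ∈ V) →
      ∀ v ∈ V, (freeLieSuperalgebra sylvesterParity).bracket g v ∈ V := by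
    intro g hg
    change V ≤ V.comap ((freeLieSuperalgebra sylvesterParity).bracket g)
    refine sup_le (Submodule.span_le.2 ?_) fun y hy => ?_
    · rintro _ ⟨i, rfl⟩
      exact hg i
    · exact Submodule.mem_sup_right
        ((freeLieSuperalgebra sylvesterParity).bracket_mem_idealSpan s g hy)
  apply freeLieSuper_eq_top
  · rintro (_ | _)
    exacts [hD, hS]
  · rintro (_ | _)
    exacts [stable _ hDt, stable _ hSt]

variable {E : ι → Matrix (Fin (2 * n)) (Fin (2 * n)) ℂ} {γ : ι → ℂ}

/-- Relations that hold for Sylvester's matrices form a defining set if modulo them the elements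
`t i` span, provided that the values of the `t i` are multiples of linearly independent matrices and
that those `t i` whose values vanish are consequences of the relations. -/
theorem isDefiningSet_of_span_sup_eq_top [Fintype ι]
    (hs : ∀ x ∈ s, (freeLieSuperalgebra sylvesterParity).IsHomogeneous x)
    (hev : ∀ x ∈ s, (sylvesterEval n).toLinearMap x = 0)
    (hE : LinearIndependent ℂ E) (ht : ∀ i, (sylvesterEval n).toLinearMap (t i) = γ i • E i)
    (hγ : ∀ i, γ i = 0 → t i ∈ (freeLieSuperalgebra sylvesterParity).idealSpan s)
    (htop : Submodule.span ℂ (Set.range t) ⊔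
      (freeLieSuperalgebra sylvesterParity).idealSpan s = ⊤) : IsDefiningSet n s := by
  refine ⟨hs, le_antisymm ((sylvesterEval n).idealSpan_le_ker hev) fun x hx => ?_⟩
  obtain ⟨y, hy, z, hz, rfl⟩ := Submodule.mem_sup.1 (htop ▸ Submodule.mem_top (x := x))
  obtain ⟨c, rfl⟩ := (Submodule.mem_span_range_iff_exists_fun ℂ).1 hy
  have hz0 := (sylvesterEval n).idealSpan_le_ker hev hz
  rw [LinearMap.mem_ker] at hx hz0
  rw [map_add, hz0, add_zero, map_sum] at hx
  simp only [map_smul, ht, smul_smul] at hx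
  -- Each product c i * γ i vanishes: either the term drops out, or `t i` already lies in the ideal.
  have h0 := Fintype.linearIndependent_iff.1 hE _ hx
  refine Submodule.add_mem _ (Submodule.sum_mem _ fun i _ => ?_) hz
  rcases mul_eq_zero.1 (h0 i) with h | h
  · rw [h, zero_smul]
    exact Submodule.zero_mem _
  · exact Submodule.smul_mem _ _ (hγ i h)

/-- The ideal evaluates to zero, so only the span of the `t i` contributes to the image. -/
theorem sylvesterSpan_eq_span (hev : ∀ x ∈ s, (sylvesterEval n).toLinearMap x = 0)
    (ht : ∀ i, (sylvesterEval n).toLinearMap (t i) = γ i • E i)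
    (htop : Submodule.span ℂ (Set.range t) ⊔
      (freeLieSuperalgebra sylvesterParity).idealSpan s = ⊤) :
    sylvesterSpan n = Submodule.span ℂ (Set.range fun i => γ i • E i) := by
  rw [sylvesterSpan, LinearMap.range_eq_map, ← htop, Submodule.map_sup,
    (LinearMap.le_ker_iff_map (f := (sylvesterEval n).toLinearMap)).1
      ((sylvesterEval n).idealSpan_le_ker hev), sup_bot_eq, Submodule.map_span, ← Set.range_comp]
  congr 2
  funext i
  exact ht i

end Presentation

theorem relationNumber_le {n : ℕ} {s : Set FreeSylvester} (hs : IsDefiningSet n s) :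
    relationNumber n ≤ s.encard :=
  iInf₂_le s hs

/-! ### Parities and first brackets of the generators -/

theorem genD_mem_part : genD ∈ (freeLieSuperalgebra sylvesterParity).part 0 :=
  freeGen_mem_part sylvesterParity .D

theorem genS_mem_part : genS ∈ (freeLieSuperalgebra sylvesterParity).part 1 :=
  freeGen_mem_part sylvesterParity .S

theorem adD_mem_part {k : ZMod 2} {x : FreeSylvester}
    (hx : x ∈ (freeLieSuperalgebra sylvesterParity).part k) :
    adD x ∈ (freeLieSuperalgebra sylvesterParity).part k := by
  have h := (freeLieSuperalgebra sylvesterParity).bracket_mem genD_mem_part hx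
  rwa [zero_add] at h

theorem adS_mem_part {k : ZMod 2} {x : FreeSylvester}
    (hx : x ∈ (freeLieSuperalgebra sylvesterParity).part k) :
    adS x ∈ (freeLieSuperalgebra sylvesterParity).part (k + 1) := by
  have h := (freeLieSuperalgebra sylvesterParity).bracket_mem genS_mem_part hx
  rwa [add_comm] at h

theorem adD_pow_mem_part {k : ZMod 2} {x : FreeSylvester}
    (hx : x ∈ (freeLieSuperalgebra sylvesterParity).part k) (j : ℕ) :
    (adD ^ j) x ∈ (freeLieSuperalgebra sylvesterParity).part k := by
  induction j with
  | zero => simpa using hx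
  | succ j ih => rw [pow_succ', Module.End.mul_apply]; exact adD_mem_part ih

theorem adS_pow_mem_part {k : ZMod 2} {x : FreeSylvester}
    (hx : x ∈ (freeLieSuperalgebra sylvesterParity).part k) (j : ℕ) :
    (adS ^ j) x ∈ (freeLieSuperalgebra sylvesterParity).part (k + (j : ZMod 2)) := by
  induction j with
  | zero => simpa using hx
  | succ j ih =>
    rw [pow_succ', Module.End.mul_apply, Nat.cast_succ, ← add_assoc]
    exact adS_mem_part ih

theorem adD_genD : adD genD = 0 := by
  have h := (freeLieSuperalgebra sylvesterParity).skew genD_mem_part genD_mem_part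
  simp only [superSign, ZMod.val_zero, mul_zero, pow_zero, one_smul] at h
  rw [eq_neg_iff_add_eq_zero, ← two_smul ℂ] at h
  exact (smul_eq_zero.1 h).resolve_left two_ne_zero

theorem adS_genD : adS genD = -adD genS := by
  have h := (freeLieSuperalgebra sylvesterParity).skew genS_mem_part genD_mem_part
  simp only [superSign, ZMod.val_zero, mul_zero, pow_zero, one_smul] at h
  exact h

/-- `[D, [S, S]] = 2 [S, [D, S]]`. -/
theorem adD_adS_genS : adD (adS genS) = (2 : ℂ) • adS (adD genS) := by
  have h := (freeLieSuperalgebra sylvesterParity).jacobi genD_mem_part genS_mem_part genS_mem_part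
  have h' := (freeLieSuperalgebra sylvesterParity).skew (adD_mem_part genS_mem_part) genS_mem_part
  simp only [superSign, ZMod.val_zero, pow_zero, one_smul, ZMod.val_one, mul_one, pow_one,
    neg_smul, neg_neg] at h h'
  change adD (adS genS) = (freeLieSuperalgebra sylvesterParity).bracket (adD genS) genS +
    adS (adD genS) at h
  rw [h, h', two_smul]
  rfl

theorem matrixSuperbracket_even {ι : Type*} [Fintype ι] {p : ι → ZMod 2} {l : ZMod 2}
    {A B : Matrix ι ι ℂ} (hA : A ∈ matrixPart p 0) (hB : B ∈ matrixPart p l) :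
    (glSuper p).bracket A B = A * B - B * A := by
  refine (matrixSuperbracket_apply hA hB).trans ?_
  simp [superSign]

/-- The parity of `B` is given by a natural number because D^k S^m has parity m; the sign then reads
(-1)^m. -/
theorem matrixSuperbracket_odd {ι : Type*} [Fintype ι] {p : ι → ZMod 2} {m : ℕ}
    {A B : Matrix ι ι ℂ} (hA : A ∈ matrixPart p 1) (hB : B ∈ matrixPart p (m : ZMod 2)) :
    (glSuper p).bracket A B = A * B - (-1 : ℂ) ^ m • (B * A) := by
  refine (matrixSuperbracket_apply hA hB).trans ?_
  rw [superSign, ZMod.val_one, one_mul, ZMod.val_natCast, ← neg_one_pow_eq_pow_mod_two]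

/-! ### Powers of the root of unity -/

/-- The primitive `2n`-th root of unity `a = exp(2πi/(2n))`. -/
noncomputable def sylvesterRoot (n : ℕ) : ℂ :=
  Complex.exp (2 * Real.pi * Complex.I / ((2 * n : ℕ) : ℂ))


theorem sylvesterRoot_isPrimitiveRoot {n : ℕ} (hn : 1 ≤ n) :
    IsPrimitiveRoot (sylvesterRoot n) (2 * n) :=
  Complex.isPrimitiveRoot_exp (2 * n) (by omega)

theorem sylvesterRoot_pow_two_mul {n : ℕ} (hn : 1 ≤ n) : sylvesterRoot n ^ (2 * n) = 1 :=
  (sylvesterRoot_isPrimitiveRoot hn).pow_eq_one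

theorem sylvesterRoot_pow_mod {n : ℕ} (hn : 1 ≤ n) (l : ℕ) :
    sylvesterRoot n ^ (l % (2 * n)) = sylvesterRoot n ^ l := by
  rw [(sylvesterRoot_isPrimitiveRoot hn).eq_orderOf, pow_mod_orderOf]

theorem sylvesterRoot_ne_zero {n : ℕ} (hn : 1 ≤ n) : sylvesterRoot n ≠ 0 :=
  (sylvesterRoot_isPrimitiveRoot hn).ne_zero (by omega)

theorem sylvesterRoot_pow_self {n : ℕ} (hn : 1 ≤ n) : sylvesterRoot n ^ n = -1 :=
  ((sylvesterRoot_isPrimitiveRoot hn).pow (by omega)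
    (mul_comm 2 n)).eq_neg_one_of_two_right

theorem one_sub_sylvesterRoot_pow_ne_zero {n : ℕ} (hn : 1 ≤ n) {m : ℕ} (h1 : 1 ≤ m)
    (h2 : m < 2 * n) : 1 - sylvesterRoot n ^ m ≠ 0 := by
  rw [sub_ne_zero]
  exact ((sylvesterRoot_isPrimitiveRoot hn).pow_ne_one_of_pos_of_lt (by omega) h2).symm

/-- Since -1 = a^n, only the exponent n could give a zero. Powers are injective on exponents below
2n, which leaves k = 2n as a separate case. -/
theorem sylvesterRoot_pow_add_one_ne_zero {n : ℕ} (hn : 1 ≤ n) {k : ℕ} (h1 : 1 ≤ k)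
    (h2 : k ≤ 2 * n) (h3 : k ≠ n) : sylvesterRoot n ^ k + 1 ≠ 0 := by
  intro h
  rw [← sub_neg_eq_add, sub_eq_zero, ← sylvesterRoot_pow_self hn] at h
  rcases h2.lt_or_eq with h2 | rfl
  · exact h3 ((sylvesterRoot_isPrimitiveRoot hn).pow_inj h2 (by omega) h)
  · rw [sylvesterRoot_pow_two_mul hn, sylvesterRoot_pow_self hn] at h
    norm_num at h

/-- For n > 1 the root a is neither 1 nor -1, so the steps down column 1 have nonzero weights. -/
theorem sylvesterRoot_sub_neg_one_pow_ne_zero {n : ℕ} (h1 : 1 < n) (j : ℕ) :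
    sylvesterRoot n - (-1) ^ j ≠ 0 := by
  rcases neg_one_pow_eq_or ℂ j with h | h <;> rw [h]
  · have := one_sub_sylvesterRoot_pow_ne_zero h1.le le_rfl (by omega)
    rwa [pow_one, ← neg_sub, neg_ne_zero] at this
  · have := sylvesterRoot_pow_add_one_ne_zero h1.le (k := 1) le_rfl (by omega) (by omega)
    rwa [pow_one, ← sub_neg_eq_add] at this


/-! ### The basis of monomials and the action of the generators -/

/-- The products `D^k S^m` of Sylvester's matrices. -/
noncomputable def sylvesterMonomial (n k m : ℕ) : Matrix (Fin (2 * n)) (Fin (2 * n)) ℂ :=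
  Matrix.of fun i j => if j.val = (i.val + m) % (2 * n) then sylvesterRoot n ^ (k * i.val) else 0

theorem sylvesterMonomial_apply (n k m : ℕ) (i j : Fin (2 * n)) :
    sylvesterMonomial n k m i j =
      if j.val = (i.val + m) % (2 * n) then sylvesterRoot n ^ (k * i.val) else 0 := rfl

theorem sylvesterMatrix_D (n : ℕ) : sylvesterMatrix n .D = sylvesterMonomial n 1 0 := by
  ext i j
  rw [sylvesterMonomial_apply, add_zero, Nat.mod_eq_of_lt i.isLt, one_mul]
  simp only [sylvesterMatrix, Matrix.diagonal_apply, Fin.ext_iff, eq_comm]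
  rfl

theorem sylvesterMatrix_S (n : ℕ) : sylvesterMatrix n .S = sylvesterMonomial n 0 1 := by
  ext i j
  rw [sylvesterMonomial_apply, zero_mul, pow_zero]
  rfl

theorem sylvesterMonomial_zero_zero (n : ℕ) : sylvesterMonomial n 0 0 = 1 := by
  ext i j
  rw [sylvesterMonomial_apply, add_zero, Nat.mod_eq_of_lt i.isLt, zero_mul, pow_zero,
    Matrix.one_apply]
  simp only [Fin.ext_iff, eq_comm]

theorem sylvesterMonomial_mem (n k m : ℕ) :
    sylvesterMonomial n k m ∈ matrixPart (alternating n) (m : ZMod 2) := by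
  intro i j h
  rw [sylvesterMonomial_apply, if_neg]
  intro hj
  apply h
  have h2 : ((j.val : ℕ) : ZMod 2) = ((i.val + m : ℕ) : ZMod 2) := by
    rw [ZMod.natCast_eq_natCast_iff', hj, Nat.mod_mod_of_dvd _ (dvd_mul_right 2 n)]
  change (i.val : ZMod 2) + (j.val : ZMod 2) = m
  rw [h2, Nat.cast_add, ← add_assoc, CharTwo.add_self_eq_zero, zero_add]

/-- This is S^{2n} = 1. Together with D^{2n} = 1 it allows exponents from 1 to 2n, as in the grid,
with the identity at the corner (2n, 2n). -/
theorem sylvesterMonomial_add_period_right (n k m : ℕ) :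
    sylvesterMonomial n k (m + 2 * n) = sylvesterMonomial n k m := by
  ext i j
  rw [sylvesterMonomial_apply, sylvesterMonomial_apply, ← add_assoc, Nat.add_mod_right]


theorem sylvesterMonomial_add_period_left {n : ℕ} (hn : 1 ≤ n) (k m : ℕ) :
    sylvesterMonomial n (k + 2 * n) m = sylvesterMonomial n k m := by
  ext i j
  rw [sylvesterMonomial_apply, sylvesterMonomial_apply, add_mul, pow_add, pow_mul _ (2 * n),
    sylvesterRoot_pow_two_mul hn, one_pow, mul_one]

/-- Iterating SD = aDS, moving S^m past D^{k'} costs the factor a^{mk'}. -/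
theorem sylvesterMonomial_mul {n : ℕ} (hn : 1 ≤ n) (k m k' m' : ℕ) :
    sylvesterMonomial n k m * sylvesterMonomial n k' m' =
      sylvesterRoot n ^ (m * k') • sylvesterMonomial n (k + k') (m + m') := by
  ext i j
  rw [Matrix.mul_apply, Finset.sum_eq_single ⟨(i.val + m) % (2 * n), Nat.mod_lt _ (by omega)⟩]
  · have h : sylvesterRoot n ^ (k' * ((i.val + m) % (2 * n))) =
        sylvesterRoot n ^ (k' * (i.val + m)) := by
      rw [mul_comm, pow_mul, sylvesterRoot_pow_mod hn, ← pow_mul, mul_comm]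
    simp only [Matrix.smul_apply, sylvesterMonomial_apply, if_true, h, Nat.mod_add_mod, smul_eq_mul,
      mul_ite, mul_zero, ← pow_add, add_assoc]
    congr 2
    ring
  · intro l _ hl
    rw [sylvesterMonomial_apply, if_neg, zero_mul]
    exact fun h => hl (Fin.ext h)
  · simp

theorem bracket_sylvesterMatrix_D {n : ℕ} (hn : 1 ≤ n) (k m : ℕ) :
    (glSuper (alternating n)).bracket (sylvesterMatrix n .D) (sylvesterMonomial n k m) =
      (1 - sylvesterRoot n ^ m) • sylvesterMonomial n (k + 1) m := by
  rw [matrixSuperbracket_even (sylvesterMatrix_mem n .D) (sylvesterMonomial_mem n k m),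
    sylvesterMatrix_D, sylvesterMonomial_mul hn, sylvesterMonomial_mul hn, sub_smul]
  simp [add_comm]

/-- The weight vanishes exactly when k ≡ 0 with m even, or k ≡ n with m odd, k being taken modulo
2n. The second case at m = 2n - 1 produces the zero at T_{2n}^n. -/
theorem bracket_sylvesterMatrix_S {n : ℕ} (hn : 1 ≤ n) (k m : ℕ) :
    (glSuper (alternating n)).bracket (sylvesterMatrix n .S) (sylvesterMonomial n k m) =
      (sylvesterRoot n ^ k - (-1) ^ m) • sylvesterMonomial n k (m + 1) := by
  rw [matrixSuperbracket_odd (sylvesterMatrix_mem n .S) (sylvesterMonomial_mem n k m),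
    sylvesterMatrix_S, sylvesterMonomial_mul hn, sylvesterMonomial_mul hn, sub_smul]
  simp [add_comm]

/-- Different powers of S occupy disjoint cyclic diagonals. On a single diagonal independence is the
Vandermonde argument at the distinct nodes a^i. -/
theorem linearIndependent_sylvesterMonomial {n : ℕ} (hn : 1 ≤ n) :
    LinearIndependent ℂ fun x : Fin (2 * n) × Fin (2 * n) =>
      sylvesterMonomial n (x.1 + 1) (x.2 + 1) := by
  rw [Fintype.linearIndependent_iff]
  intro c hc
  have key : ∀ m : Fin (2 * n), (fun k : Fin (2 * n) => c (k, m)) = 0 := by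
    intro m
    apply Matrix.eq_zero_of_forall_index_sum_mul_pow_eq_zero
      (f := fun i : Fin (2 * n) => sylvesterRoot n ^ i.val)
    · exact fun i j h =>
        Fin.ext ((sylvesterRoot_isPrimitiveRoot hn).pow_inj i.isLt j.isLt h)
    · intro i
      have hi := congrFun (congrFun hc i) ⟨(i.val + (m.val + 1)) % (2 * n), Nat.mod_lt _ (by omega)⟩
      rw [Fintype.sum_prod_type, Matrix.sum_apply] at hi
      -- The entry in column i + m + 1 sees only the diagonal of `m`; the extra factor a^i appears
      -- because the exponents of D are k + 1.
      have hrow : ∀ k : Fin (2 * n), (∑ m' : Fin (2 * n), c (k, m') •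
          sylvesterMonomial n (k + 1) (m' + 1)) i
            ⟨(i.val + (m.val + 1)) % (2 * n), Nat.mod_lt _ (by omega)⟩ =
          sylvesterRoot n ^ i.val * (c (k, m) * (sylvesterRoot n ^ i.val) ^ k.val) := by
        intro k
        rw [Matrix.sum_apply, Finset.sum_eq_single m]
        · rw [Matrix.smul_apply, sylvesterMonomial_apply, if_pos rfl, smul_eq_mul]
          ring
        · intro m' _ hm'
          rw [Matrix.smul_apply, sylvesterMonomial_apply, if_neg, smul_zero]
          intro h
          have h' : i.val + 1 + m.val ≡ i.val + 1 + m'.val [MOD 2 * n] := by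
            simpa [Nat.ModEq, add_assoc, add_comm, add_left_comm] using h
          have h'' := Nat.ModEq.add_left_cancel' _ h'
          exact hm' (Fin.ext (Nat.ModEq.eq_of_lt_of_lt h'' m.isLt m'.isLt).symm)
        · simp
      simp only [hrow] at hi
      rw [← Finset.mul_sum] at hi
      exact (mul_eq_zero.1 hi).resolve_left (pow_ne_zero _ (sylvesterRoot_ne_zero hn))
  intro x
  exact congrFun (key x.2) x.1

theorem span_sylvesterMonomial {n : ℕ} (hn : 1 ≤ n) :
    Submodule.span ℂ (Set.range fun x : Fin (2 * n) × Fin (2 * n) =>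
      sylvesterMonomial n (x.1 + 1) (x.2 + 1)) = ⊤ :=
  (linearIndependent_sylvesterMonomial hn).span_eq_top_of_card_eq_finrank' (by
    simp [Module.finrank_matrix])

/-! ### Supertraces of monomials -/

theorem supertrace_apply {ι : Type*} [Fintype ι] (p : ι → ZMod 2) (A : Matrix ι ι ℂ) :
    supertrace p A = ∑ i, (-1 : ℂ) ^ (p i).val * A i i := rfl

theorem supertrace_sylvesterMonomial_of_lt {n : ℕ} (hn : 1 ≤ n) {k m : ℕ} (h1 : 1 ≤ m)
    (h2 : m < 2 * n) : supertrace (alternating n) (sylvesterMonomial n k m) = 0 := by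
  rw [supertrace_apply]
  refine Finset.sum_eq_zero fun i _ => ?_
  rw [sylvesterMonomial_apply, if_neg, mul_zero]
  intro h
  have h' : i.val + 0 ≡ i.val + m [MOD 2 * n] := by
    rw [Nat.ModEq, ← h, add_zero, Nat.mod_eq_of_lt i.isLt]
  have h'' := Nat.ModEq.eq_of_lt_of_lt (Nat.ModEq.add_left_cancel' _ h') (by omega) h2
  omega

/-- Here D^k S^{2n} = D^k, and the sign (-1)^i equals a^{ni}. The ratio a^{k+n} of the resulting
geometric sum is 1, among 1 ≤ k ≤ 2n, only for k = n. -/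
theorem supertrace_sylvesterMonomial_period {n : ℕ} (hn : 1 ≤ n) (k : ℕ) :
    supertrace (alternating n) (sylvesterMonomial n k (2 * n)) =
      ∑ i ∈ Finset.range (2 * n), (sylvesterRoot n ^ (k + n)) ^ i := by
  rw [← Fin.sum_univ_eq_sum_range, supertrace_apply]
  refine Finset.sum_congr rfl fun i _ => ?_
  rw [sylvesterMonomial_apply, if_pos (by rw [Nat.add_mod_right, Nat.mod_eq_of_lt i.isLt]),
    alternating, ZMod.val_natCast, ← neg_one_pow_eq_pow_mod_two, ← sylvesterRoot_pow_self hn]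
  ring

theorem supertrace_sylvesterMonomial_of_ne {n : ℕ} (hn : 1 ≤ n) {k : ℕ} (h1 : 1 ≤ k)
    (h2 : k ≤ 2 * n) (h3 : k ≠ n) : supertrace (alternating n) (sylvesterMonomial n k (2 * n)) = 0 := by
  rw [supertrace_sylvesterMonomial_period hn, geom_sum_eq, ← pow_mul, mul_comm, pow_mul,
    sylvesterRoot_pow_two_mul hn]
  · simp
  · intro h
    apply sylvesterRoot_pow_add_one_ne_zero hn h1 h2 h3
    rw [pow_add, sylvesterRoot_pow_self hn] at h
    linear_combination -h

theorem supertrace_sylvesterMonomial_self_ne_zero {n : ℕ} (hn : 1 ≤ n) :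
    supertrace (alternating n) (sylvesterMonomial n n (2 * n)) ≠ 0 := by
  rw [supertrace_sylvesterMonomial_period hn, ← two_mul, sylvesterRoot_pow_two_mul hn]
  simp
  omega

/-! ### Evaluation of iterated brackets -/

theorem sylvesterEval_adD (n : ℕ) (x : FreeSylvester) :
    (sylvesterEval n).toLinearMap (adD x) = (glSuper (alternating n)).bracket
      (sylvesterMatrix n .D) ((sylvesterEval n).toLinearMap x) := by
  rw [adD, (sylvesterEval n).map_bracket, genD, sylvesterEval, LieSuperalgebra.lift_freeGen]

theorem sylvesterEval_adS (n : ℕ) (x : FreeSylvester) :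
    (sylvesterEval n).toLinearMap (adS x) = (glSuper (alternating n)).bracket
      (sylvesterMatrix n .S) ((sylvesterEval n).toLinearMap x) := by
  rw [adS, (sylvesterEval n).map_bracket, genS, sylvesterEval, LieSuperalgebra.lift_freeGen]

theorem sylvesterEval_genD (n : ℕ) :
    (sylvesterEval n).toLinearMap genD = (1 : ℂ) • sylvesterMonomial n 1 0 := by
  rw [one_smul, ← sylvesterMatrix_D, genD, sylvesterEval, LieSuperalgebra.lift_freeGen]

theorem sylvesterEval_genS (n : ℕ) :
    (sylvesterEval n).toLinearMap genS = (1 : ℂ) • sylvesterMonomial n 0 1 := by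
  rw [one_smul, ← sylvesterMatrix_S, genS, sylvesterEval, LieSuperalgebra.lift_freeGen]

/-- Values of the form r • D^k S^m keep this form under both generators, so nested brackets are
evaluated by chaining this lemma and its analogue for S. -/
theorem sylvesterEval_adD_of_eq {n : ℕ} (hn : 1 ≤ n) {x : FreeSylvester} {r : ℂ} {k m : ℕ}
    (hx : (sylvesterEval n).toLinearMap x = r • sylvesterMonomial n k m) :
    (sylvesterEval n).toLinearMap (adD x) =
      (r * (1 - sylvesterRoot n ^ m)) • sylvesterMonomial n (k + 1) m := by
  rw [sylvesterEval_adD, hx, map_smul, bracket_sylvesterMatrix_D hn, smul_smul]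

theorem sylvesterEval_adS_of_eq {n : ℕ} (hn : 1 ≤ n) {x : FreeSylvester} {r : ℂ} {k m : ℕ}
    (hx : (sylvesterEval n).toLinearMap x = r • sylvesterMonomial n k m) :
    (sylvesterEval n).toLinearMap (adS x) =
      (r * (sylvesterRoot n ^ k - (-1) ^ m)) • sylvesterMonomial n k (m + 1) := by
  rw [sylvesterEval_adS, hx, map_smul, bracket_sylvesterMatrix_S hn, smul_smul]

theorem sylvesterEval_adD_pow_of_eq {n : ℕ} (hn : 1 ≤ n) {x : FreeSylvester} {r : ℂ} {k m : ℕ}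
    (hx : (sylvesterEval n).toLinearMap x = r • sylvesterMonomial n k m) (j : ℕ) :
    (sylvesterEval n).toLinearMap ((adD ^ j) x) =
      (r * (1 - sylvesterRoot n ^ m) ^ j) • sylvesterMonomial n (k + j) m := by
  induction j with
  | zero => simpa using hx
  | succ j ih =>
    rw [pow_succ', Module.End.mul_apply, sylvesterEval_adD_of_eq hn ih, pow_succ, ← mul_assoc,
      add_assoc]

theorem sylvesterEval_adD_genS {n : ℕ} (hn : 1 ≤ n) :
    (sylvesterEval n).toLinearMap (adD genS) =
      (1 - sylvesterRoot n) • sylvesterMonomial n 1 1 := by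
  simpa using sylvesterEval_adD_of_eq hn (sylvesterEval_genS n)

theorem sylvesterEval_adS_genS {n : ℕ} (hn : 1 ≤ n) :
    (sylvesterEval n).toLinearMap (adS genS) = (2 : ℂ) • sylvesterMonomial n 0 2 := by
  have h := sylvesterEval_adS_of_eq hn (sylvesterEval_genS n)
  norm_num at h
  exact h

/-! ### The grid of elements T_m^k and their values -/

/-- The coefficient of `D S^m` in `(ad S)^{m-1} [D, S]`, evaluated at Sylvester's matrices. -/
noncomputable def columnCoeff (n m : ℕ) : ℂ :=
  (1 - sylvesterRoot n) * ∏ i ∈ Finset.range (m - 1), (sylvesterRoot n - (-1) ^ (i + 1))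

theorem columnCoeff_ne_zero {n : ℕ} (hn : 1 < n) (m : ℕ) : columnCoeff n m ≠ 0 := by
  refine mul_ne_zero ?_ (Finset.prod_ne_zero_iff.2 fun i _ =>
    sylvesterRoot_sub_neg_one_pow_ne_zero hn _)
  simpa using one_sub_sylvesterRoot_pow_ne_zero hn.le le_rfl (by omega)

theorem sylvesterEval_adS_pow {n : ℕ} (hn : 1 ≤ n) {m : ℕ} (hm : 1 ≤ m) :
    (sylvesterEval n).toLinearMap ((adS ^ (m - 1)) (adD genS)) =
      columnCoeff n m • sylvesterMonomial n 1 m := by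
  induction m, hm using Nat.le_induction with
  | base => simpa [columnCoeff] using sylvesterEval_adD_genS hn
  | succ m hm ih =>
    obtain ⟨l, rfl⟩ := Nat.exists_eq_add_of_le' hm
    simp only [Nat.add_sub_cancel] at ih ⊢
    rw [pow_succ', Module.End.mul_apply, sylvesterEval_adS_of_eq hn ih, columnCoeff, columnCoeff,
      Nat.add_sub_cancel, Nat.add_sub_cancel, Finset.prod_range_succ, pow_one, mul_assoc]

/-- The coefficient of `D^k S^m` in `T_m^k`, evaluated at Sylvester's matrices. -/
noncomputable def gridCoeff (n m k : ℕ) : ℂ :=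
  if m = 2 * n then
    -- Row 2n is reached from D^k S^{2n-1} by ad S, with weight a^k - (-1)^{2n-1} = a^k + 1; this is
    -- the factor that vanishes at k = n.
    columnCoeff n (m - 1) * (1 - sylvesterRoot n ^ (m - 1)) ^ (k - 1) * (sylvesterRoot n ^ k + 1)
  else columnCoeff n m * (1 - sylvesterRoot n ^ m) ^ (k - 1)

theorem gridCoeff_ne_zero {n : ℕ} (hn : 1 < n) {m k : ℕ} (hm : 1 ≤ m) (hm' : m ≤ 2 * n)
    (hk : 1 ≤ k) (hk' : k ≤ 2 * n) (h : ¬ (m = 2 * n ∧ k = n)) : gridCoeff n m k ≠ 0 := by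
  rw [gridCoeff]
  split_ifs with hmn
  · exact mul_ne_zero (mul_ne_zero (columnCoeff_ne_zero hn _)
      (pow_ne_zero _ (one_sub_sylvesterRoot_pow_ne_zero hn.le (by omega) (by omega))))
      (sylvesterRoot_pow_add_one_ne_zero hn.le hk hk' fun hkn => h ⟨hmn, hkn⟩)
  · exact mul_ne_zero (columnCoeff_ne_zero hn _)
      (pow_ne_zero _ (one_sub_sylvesterRoot_pow_ne_zero hn.le hm (by omega)))

theorem gridCoeff_eq_zero {n : ℕ} (hn : 1 ≤ n) : gridCoeff n (2 * n) n = 0 := by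
  rw [gridCoeff, if_pos rfl, sylvesterRoot_pow_self hn, neg_add_cancel, mul_zero]

theorem gridT_of_lt {n m : ℕ} (hm : m < 2 * n) (k : ℕ) :
    gridT n m k = (adD ^ (k - 1)) ((adS ^ (m - 1)) (adD genS)) := by
  rw [gridT, if_neg hm.ne]

/-- Steps into the last row hold by definition for every k, so stability requires no relations for
them. -/
theorem adS_gridT_penultimate {n : ℕ} (hn : 1 ≤ n) (k : ℕ) :
    adS (gridT n (2 * n - 1) k) = gridT n (2 * n) k := by
  rw [gridT_of_lt (by omega), gridT, if_pos rfl, Nat.sub_sub]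

theorem adS_gridT_one {n m : ℕ} (hm : 1 ≤ m) (hm' : m + 1 < 2 * n) :
    adS (gridT n m 1) = gridT n (m + 1) 1 := by
  obtain ⟨l, rfl⟩ := Nat.exists_eq_add_of_le' hm
  rw [gridT_of_lt (by omega), gridT_of_lt hm']
  simp only [Nat.add_sub_cancel, Nat.sub_self, pow_zero, Module.End.one_apply]
  rw [pow_succ', Module.End.mul_apply]

/-- There is no upper bound on k + j: this lets [D, T_m^{2n}] be read as T_m^{2n+1} and rewritten as
(ad D)^{2n} T_m^1. The bound 1 ≤ k avoids the truncated k - 1. -/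
theorem adD_pow_gridT {n m : ℕ} (hm : m < 2 * n) (j : ℕ) {k : ℕ} (hk : 1 ≤ k) :
    (adD ^ j) (gridT n m k) = gridT n m (k + j) := by
  rw [gridT_of_lt hm, gridT_of_lt hm, ← Module.End.mul_apply, ← pow_add]
  congr 2
  omega

theorem adD_gridT {n m k : ℕ} (hm : m < 2 * n) (hk : 1 ≤ k) :
    adD (gridT n m k) = gridT n m (k + 1) := by
  simpa using adD_pow_gridT hm 1 hk

theorem gridT_one_one {n : ℕ} (hn : 1 ≤ n) : gridT n 1 1 = adD genS := by
  rw [gridT_of_lt (by omega)]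
  simp

theorem sylvesterEval_gridT {n : ℕ} (hn : 1 ≤ n) {m k : ℕ} (hm : 1 ≤ m) (hm' : m ≤ 2 * n)
    (hk : 1 ≤ k) : (sylvesterEval n).toLinearMap (gridT n m k) =
      gridCoeff n m k • sylvesterMonomial n k m := by
  have row : ∀ {m}, 1 ≤ m → m < 2 * n → (sylvesterEval n).toLinearMap (gridT n m k) =
      (columnCoeff n m * (1 - sylvesterRoot n ^ m) ^ (k - 1)) • sylvesterMonomial n k m := by
    intro m hm hm'
    rw [gridT_of_lt hm', sylvesterEval_adD_pow_of_eq hn (sylvesterEval_adS_pow hn hm),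
      Nat.add_sub_cancel' hk]
  rcases hm'.lt_or_eq with h | rfl
  · rw [row hm h, gridCoeff, if_neg h.ne]
  · rw [← adS_gridT_penultimate hn, sylvesterEval_adS_of_eq hn (row (by omega) (by omega)),
      gridCoeff, if_pos rfl, Nat.sub_add_cancel hm, Odd.neg_one_pow ⟨n - 1, by omega⟩,
      sub_neg_eq_add]

theorem gridT_mem_part {n : ℕ} (hn : 1 ≤ n) {m : ℕ} (hm : 1 ≤ m) (hm' : m ≤ 2 * n) (k : ℕ) :
    gridT n m k ∈ (freeLieSuperalgebra sylvesterParity).part (m : ZMod 2) := by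
  have row : ∀ {m}, 1 ≤ m → m < 2 * n →
      gridT n m k ∈ (freeLieSuperalgebra sylvesterParity).part (m : ZMod 2) := by
    intro m hm hm'
    obtain ⟨l, rfl⟩ := Nat.exists_eq_add_of_le' hm
    rw [gridT_of_lt hm', Nat.cast_succ, add_comm]
    exact adD_pow_mem_part (adS_pow_mem_part (adD_mem_part genS_mem_part) l) _
  rcases hm'.lt_or_eq with h | rfl
  · exact row hm h
  · rw [← adS_gridT_penultimate hn]
    have h := adS_mem_part (row (m := 2 * n - 1) (by omega) (by omega))
    rwa [← Nat.cast_succ, Nat.succ_eq_add_one, Nat.sub_add_cancel hm] at h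

theorem isHomogeneous_adD_gridT {n : ℕ} (hn : 1 ≤ n) {m : ℕ} (hm : 1 ≤ m) (hm' : m ≤ 2 * n)
    (k : ℕ) : (freeLieSuperalgebra sylvesterParity).IsHomogeneous (adD (gridT n m k)) :=
  ⟨_, adD_mem_part (gridT_mem_part hn hm hm' k)⟩

/-- The alternatives in `h` are a step down and the wrap from row 2n to row 1; as 2n is even, the
parities match in both. -/
theorem isHomogeneous_adS_gridT_sub {n : ℕ} (hn : 1 ≤ n) {m m' : ℕ} (hm : 1 ≤ m)
    (hmn : m ≤ 2 * n) (hm' : 1 ≤ m') (hmn' : m' ≤ 2 * n) (h : m' = m + 1 ∨ m + 1 = m' + 2 * n)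
    (k : ℕ) (r : ℂ) : (freeLieSuperalgebra sylvesterParity).IsHomogeneous
      (adS (gridT n m k) - r • gridT n m' k) := by
  refine ⟨_, Submodule.sub_mem _ (adS_mem_part (gridT_mem_part hn hm hmn k))
    (Submodule.smul_mem _ _ ?_)⟩
  have e : (m : ZMod 2) + 1 = (m' : ZMod 2) := by
    rw [← Nat.cast_succ, ZMod.natCast_eq_natCast_iff']
    omega
  rw [e]
  exact gridT_mem_part hn hm' hmn' k

/-! ### Coefficients and validity of the relations for n > 1 -/

/-- The coefficients `c_{m,k}` of the relations `[S, T_m^k] = c_{m,k} T_{m+1}^k`. -/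
noncomputable def stepCoeff (n m k : ℕ) : ℂ :=
  gridCoeff n m k * (sylvesterRoot n ^ k - (-1) ^ m) /
    -- The denominator is the coefficient of the target: D itself for m = 2n - 1, row 1 for m = 2n
    -- because S^{2n} = 1, and the next row otherwise.
    if m = 2 * n - 1 then 1 else if m = 2 * n then gridCoeff n 1 k else gridCoeff n (m + 1) k

/-- The bound m + 2 ≤ 2n keeps the target above the last row, so its coefficient is nonzero for
every k and the division is legitimate. -/
theorem sylvesterEval_adS_gridT_sub {n : ℕ} (hn : 1 < n) {m k : ℕ} (hm : 1 ≤ m)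
    (hm' : m + 2 ≤ 2 * n) (hk : 1 ≤ k) (hk' : k ≤ 2 * n) : (sylvesterEval n).toLinearMap
      (adS (gridT n m k) - stepCoeff n m k • gridT n (m + 1) k) = 0 := by
  rw [map_sub, map_smul,
    sylvesterEval_adS_of_eq hn.le (sylvesterEval_gridT hn.le hm (by omega) hk),
    sylvesterEval_gridT hn.le (by omega) (by omega) hk, smul_smul, stepCoeff, if_neg (by omega),
    if_neg (by omega),
    div_mul_cancel₀ _ (gridCoeff_ne_zero hn (by omega) (by omega) hk hk' (by omega)), sub_self]

theorem sylvesterEval_adS_gridT_last_sub {n : ℕ} (hn : 1 < n) {k : ℕ} (hk : 1 ≤ k)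
    (hk' : k ≤ 2 * n) : (sylvesterEval n).toLinearMap
      (adS (gridT n (2 * n) k) - stepCoeff n (2 * n) k • gridT n 1 k) = 0 := by
  rw [map_sub, map_smul,
    sylvesterEval_adS_of_eq hn.le (sylvesterEval_gridT hn.le (by omega) le_rfl hk),
    sylvesterEval_gridT hn.le (by omega) (by omega) hk, smul_smul, stepCoeff, if_neg (by omega),
    if_pos rfl, div_mul_cancel₀ _ (gridCoeff_ne_zero hn (by omega) (by omega) hk hk' (by omega)),
    add_comm (2 * n) 1, sylvesterMonomial_add_period_right, sub_self]

/-- Identifies c_{2n-1,1} with the nonzero coefficient of T_{2n}^1, so that the relation can be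
solved for D. -/
theorem stepCoeff_penultimate {n : ℕ} (hn : 1 ≤ n) :
    stepCoeff n (2 * n - 1) 1 = gridCoeff n (2 * n) 1 := by
  rw [stepCoeff, if_pos rfl, div_one, gridCoeff, if_neg (by omega), gridCoeff, if_pos rfl,
    Odd.neg_one_pow ⟨n - 1, by omega⟩, sub_neg_eq_add]

theorem sylvesterEval_adS_gridT_penultimate_sub {n : ℕ} (hn : 1 < n) :
    (sylvesterEval n).toLinearMap
      (adS (gridT n (2 * n - 1) 1) - stepCoeff n (2 * n - 1) 1 • genD) = 0 := by
  rw [adS_gridT_penultimate hn.le, map_sub, map_smul,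
    sylvesterEval_gridT hn.le (by omega) le_rfl le_rfl, stepCoeff_penultimate hn.le,
    sylvesterEval_genD, one_smul, ← sylvesterMonomial_add_period_right n 1 0, zero_add, sub_self]

theorem sylvesterEval_adD_gridT_last {n : ℕ} (hn : 1 ≤ n) {k : ℕ} (hk : 1 ≤ k) :
    (sylvesterEval n).toLinearMap (adD (gridT n (2 * n) k)) = 0 := by
  rw [sylvesterEval_adD_of_eq hn (sylvesterEval_gridT hn (by omega) le_rfl hk),
    sylvesterRoot_pow_two_mul hn, sub_self, mul_zero, zero_smul]

theorem sylvesterEval_adD_pow_sub {n : ℕ} (hn : 1 ≤ n) {x : FreeSylvester} {r : ℂ} {k m : ℕ}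
    (hx : (sylvesterEval n).toLinearMap x = r • sylvesterMonomial n k m) :
    (sylvesterEval n).toLinearMap
      ((adD ^ (2 * n)) x - (1 - sylvesterRoot n ^ m) ^ (2 * n) • x) = 0 := by
  rw [map_sub, map_smul, sylvesterEval_adD_pow_of_eq hn hx, hx,
    sylvesterMonomial_add_period_left hn, smul_smul, mul_comm r, sub_self]

theorem sylvesterEval_adS_genS_sub {n : ℕ} (hn : 1 < n) :
    (sylvesterEval n).toLinearMap
      (adS genS - (2 / gridCoeff n 2 (2 * n)) • gridT n 2 (2 * n)) = 0 := by
  rw [map_sub, map_smul, sylvesterEval_adS_genS hn.le,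
    sylvesterEval_gridT hn.le (by omega) (by omega) (by omega), smul_smul,
    div_mul_cancel₀ _ (gridCoeff_ne_zero hn (by omega) (by omega) (by omega) le_rfl (by omega)),
    ← sylvesterMonomial_add_period_left hn.le 0 2, zero_add, sub_self]

/-- The relations between Sylvester's generators for `n > 1`, with the coefficients that are
determined by the values at Sylvester's matrices. -/
noncomputable def sylvesterRelations (n : ℕ) : Set FreeSylvester :=
  relationsGrid n (fun m => (1 - sylvesterRoot n ^ m) ^ (2 * n)) (stepCoeff n)
    (2 / gridCoeff n 2 (2 * n)) ∪ relationsIdentity n ∪ {relationTwoTwo n (stepCoeff n 1 2)}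

/-- A property of all the relations may be checked family by family. -/
theorem forall_mem_sylvesterRelations {n : ℕ} {P : FreeSylvester → Prop} :
    (∀ x ∈ sylvesterRelations n, P x) ↔
      (P ((adD ^ (2 * n)) genS - (1 - sylvesterRoot n ^ 1) ^ (2 * n) • genS) ∧
        P (adS (gridT n (2 * n - 1) 1) - stepCoeff n (2 * n - 1) 1 • genD)) ∧
      (∀ m, 3 ≤ m → m ≤ 2 * n - 1 →
        P ((adD ^ (2 * n)) (gridT n m 1) - (1 - sylvesterRoot n ^ m) ^ (2 * n) • gridT n m 1)) ∧
      P (gridT n (2 * n) n) ∧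
      (∀ k, 2 ≤ k → k ≤ 2 * n - 1 → k ≠ n → P (adD (gridT n (2 * n) k))) ∧
      (∀ k, 2 ≤ k → k ≤ 2 * n - 1 → k ≠ n →
        P (adS (gridT n (2 * n) k) - stepCoeff n (2 * n) k • gridT n 1 k)) ∧
      (∀ k, 3 ≤ k → k ≤ 2 * n - 1 → P (adS (gridT n 1 k) - stepCoeff n 1 k • gridT n 2 k)) ∧
      (∀ m k, 2 ≤ m → m + 2 ≤ 2 * n → 2 ≤ k → k ≤ 2 * n →
        P (adS (gridT n m k) - stepCoeff n m k • gridT n (m + 1) k)) ∧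
      P (adS genS - (2 / gridCoeff n 2 (2 * n)) • gridT n 2 (2 * n)) ∧
      (P (adD (gridT n (2 * n) (2 * n))) ∧ P (adS (gridT n (2 * n) (2 * n)))) ∧
      P (adS (gridT n 1 2) - stepCoeff n 1 2 • gridT n 2 2) := by
  constructor
  · intro h
    refine ⟨⟨h _ ?_, h _ ?_⟩, fun m h1 h2 => h _ ?_, h _ ?_, fun k h1 h2 h3 => h _ ?_,
      fun k h1 h2 h3 => h _ ?_, fun k h1 h2 => h _ ?_, fun m k h1 h2 h3 h4 => h _ ?_, h _ ?_,
      ⟨h _ ?_, h _ ?_⟩, h _ (Or.inr rfl)⟩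
    · exact .inl <| .inl <| .inl <| .inl <| .inl <| .inl <| .inl <| .inl <| .inl <| .inl rfl
    · exact .inl <| .inl <| .inl <| .inl <| .inl <| .inl <| .inl <| .inl <| .inl <| .inr rfl
    · exact .inl <| .inl <| .inl <| .inl <| .inl <| .inl <| .inl <| .inl <| .inr ⟨m, h1, h2, rfl⟩
    · exact .inl <| .inl <| .inl <| .inl <| .inl <| .inl <| .inl <| .inr rfl
    · exact .inl <| .inl <| .inl <| .inl <| .inl <| .inl <| .inr ⟨k, h1, h2, h3, rfl⟩
    · exact .inl <| .inl <| .inl <| .inl <| .inl <| .inr ⟨k, h1, h2, h3, rfl⟩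
    · exact .inl <| .inl <| .inl <| .inl <| .inr ⟨k, h1, h2, rfl⟩
    · exact .inl <| .inl <| .inl <| .inr ⟨m, k, h1, h2, h3, h4, rfl⟩
    · exact .inl <| .inl <| .inr rfl
    · exact .inl <| .inr <| .inl rfl
    · exact .inl <| .inr <| .inr rfl
  · rintro ⟨⟨h1, h1'⟩, h2, h3, h4, h5, h6, h7, h8, ⟨h9, h9'⟩, h10⟩ x hx
    rcases hx with (((((((((rfl | rfl) | ⟨m, p, q, rfl⟩) | rfl) | ⟨k, p, q, r, rfl⟩) |
      ⟨k, p, q, r, rfl⟩) | ⟨k, p, q, rfl⟩) | ⟨m, k, p, q, r, s, rfl⟩) | rfl) | (rfl | rfl)) | rfl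
    exacts [h1, h1', h2 m p q, h3, h4 k p q r, h5 k p q r, h6 k p q, h7 m k p q r s, h8, h9, h9',
      h10]

theorem isHomogeneous_of_mem_sylvesterRelations {n : ℕ} (hn : 1 < n) :
    ∀ x ∈ sylvesterRelations n, (freeLieSuperalgebra sylvesterParity).IsHomogeneous x := by
  have powers : ∀ {k : ZMod 2} {x : FreeSylvester} (r : ℂ),
      x ∈ (freeLieSuperalgebra sylvesterParity).part k →
      (freeLieSuperalgebra sylvesterParity).IsHomogeneous ((adD ^ (2 * n)) x - r • x) :=
    fun r hx => ⟨_, Submodule.sub_mem _ (adD_pow_mem_part hx _) (Submodule.smul_mem _ r hx)⟩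
  refine forall_mem_sylvesterRelations.2 ⟨⟨powers (k := 1) _ genS_mem_part, 0, ?_⟩, fun m h1 h2 =>
    powers (k := (m : ZMod 2)) _ (gridT_mem_part hn.le (by omega) (by omega) 1),
    ⟨((2 * n : ℕ) : ZMod 2), gridT_mem_part hn.le (by omega) le_rfl n⟩, fun k h1 h2 h3 =>
    isHomogeneous_adD_gridT hn.le (by omega) le_rfl k, fun k h1 h2 h3 =>
    isHomogeneous_adS_gridT_sub hn.le (by omega) le_rfl (by omega) (by omega) (by omega) k _,
    fun k h1 h2 =>
    isHomogeneous_adS_gridT_sub hn.le (by omega) (by omega) (by omega) (by omega) (by omega) k _,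
    fun m k h1 h2 h3 h4 =>
    isHomogeneous_adS_gridT_sub hn.le (by omega) (by omega) (by omega) (by omega) (by omega) k _,
    ⟨0, ?_⟩, ⟨isHomogeneous_adD_gridT hn.le (by omega) le_rfl _,
    ⟨_, adS_mem_part (gridT_mem_part hn.le (by omega) le_rfl _)⟩⟩,
    isHomogeneous_adS_gridT_sub hn.le (by omega) (by omega) (by omega) (by omega) (by omega) 2 _⟩
  · rw [adS_gridT_penultimate hn.le]
    refine Submodule.sub_mem _ ?_ (Submodule.smul_mem _ _ genD_mem_part)
    have h := gridT_mem_part hn.le (m := 2 * n) (by omega) le_rfl 1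
    rwa [(ZMod.natCast_eq_zero_iff _ _).2 (dvd_mul_right 2 n)] at h
  · have h := adS_mem_part genS_mem_part
    rw [CharTwo.add_self_eq_zero] at h
    have h' := gridT_mem_part hn.le (m := 2) (by omega) (by omega) (2 * n)
    rw [(ZMod.natCast_eq_zero_iff _ _).2 dvd_rfl] at h'
    exact Submodule.sub_mem _ h (Submodule.smul_mem _ _ h')

theorem sylvesterEval_eq_zero_of_mem_sylvesterRelations {n : ℕ} (hn : 1 < n) :
    ∀ x ∈ sylvesterRelations n, (sylvesterEval n).toLinearMap x = 0 := by
  refine forall_mem_sylvesterRelations.2 ⟨⟨sylvesterEval_adD_pow_sub hn.le (sylvesterEval_genS n),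
    sylvesterEval_adS_gridT_penultimate_sub hn⟩, fun m h1 h2 =>
    sylvesterEval_adD_pow_sub hn.le (sylvesterEval_gridT hn.le (by omega) (by omega) le_rfl), ?_,
    fun k h1 h2 h3 => sylvesterEval_adD_gridT_last hn.le (by omega), fun k h1 h2 h3 =>
    sylvesterEval_adS_gridT_last_sub hn (by omega) (by omega), fun k h1 h2 =>
    sylvesterEval_adS_gridT_sub hn le_rfl (by omega) (by omega) (by omega), fun m k h1 h2 h3 h4 =>
    sylvesterEval_adS_gridT_sub hn (by omega) h2 (by omega) h4, sylvesterEval_adS_genS_sub hn,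
    ⟨sylvesterEval_adD_gridT_last hn.le (by omega), ?_⟩,
    sylvesterEval_adS_gridT_sub hn le_rfl (by omega) (by omega) (by omega)⟩
  · rw [sylvesterEval_gridT hn.le (by omega) le_rfl hn.le, gridCoeff_eq_zero hn.le, zero_smul]
  · rw [sylvesterEval_adS_of_eq hn.le (sylvesterEval_gridT hn.le (by omega) le_rfl (by omega)),
      sylvesterRoot_pow_two_mul hn.le, Even.neg_one_pow (even_two_mul n), sub_self, mul_zero,
      zero_smul]

/-! ### The grid spans modulo the relations -/

/-- Modulo the relations, the elements `T_m^k` span the free Lie superalgebra. -/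
theorem span_gridT_sup_idealSpan {n : ℕ} (hn : 1 < n) :
    Submodule.span ℂ (Set.range fun x : Fin (2 * n) × Fin (2 * n) =>
      gridT n (x.2 + 1) (x.1 + 1)) ⊔
      (freeLieSuperalgebra sylvesterParity).idealSpan (sylvesterRelations n) = ⊤ := by
  set t := fun x : Fin (2 * n) × Fin (2 * n) => gridT n (x.2 + 1) (x.1 + 1) with ht
  set I := (freeLieSuperalgebra sylvesterParity).idealSpan (sylvesterRelations n)
  set V := Submodule.span ℂ (Set.range t) ⊔ I with hV
  have hT : ∀ {m k}, 1 ≤ m → m ≤ 2 * n → 1 ≤ k → k ≤ 2 * n → gridT n m k ∈ V := by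
    intro m k h1 h2 h3 h4
    refine Submodule.mem_sup_left (Submodule.subset_span
      ⟨(⟨k - 1, by omega⟩, ⟨m - 1, by omega⟩), ?_⟩)
    simp only [ht, Nat.sub_add_cancel h1, Nat.sub_add_cancel h3]
  have hR : ∀ x ∈ sylvesterRelations n, x ∈ V := fun x hx =>
    Submodule.mem_sup_right (LieSuperalgebra.subset_idealSpan _ _ hx)
  obtain ⟨⟨hDS, hSD⟩, hrow, hlast, hlastD, hlastS, hfirst, hstep, hSS, ⟨hidD, hidS⟩, htwo⟩ :=
    forall_mem_sylvesterRelations.1 hR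
  have of_sub : ∀ {x y : FreeSylvester} {r : ℂ}, x - r • y ∈ V → y ∈ V → x ∈ V := by
    intro x y r h hy
    simpa using V.add_mem h (V.smul_mem r hy)
  have of_smul : ∀ {x y : FreeSylvester} {r : ℂ}, r ≠ 0 → x - r • y ∈ V → x ∈ V → y ∈ V := by
    intro x y r hr h hx
    have h' := V.smul_mem r⁻¹ (V.sub_mem hx h)
    rwa [sub_sub_cancel, smul_smul, inv_mul_cancel₀ hr, one_smul] at h'
  have T11 := gridT_one_one hn.le
  -- T_1^1 = [D, S] already contains one ad D, hence the index 2n and not 2n + 1; with b_1 ≠ 0 this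
  -- puts S into V.
  have hpow : (adD ^ (2 * n)) genS = gridT n 1 (2 * n) := by
    rw [← Nat.sub_add_cancel (show 1 ≤ 2 * n by omega), pow_succ, Module.End.mul_apply, ← T11,
      adD_pow_gridT (by omega) _ le_rfl, add_comm, Nat.sub_add_cancel (show 1 ≤ 2 * n by omega)]
  have hS : genS ∈ V := of_smul (pow_ne_zero _ (one_sub_sylvesterRoot_pow_ne_zero hn.le le_rfl
    (by omega))) hDS (hpow ▸ hT le_rfl (by omega) (by omega) le_rfl)
  have hc : stepCoeff n (2 * n - 1) 1 ≠ 0 := by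
    rw [stepCoeff_penultimate hn.le]
    exact gridCoeff_ne_zero hn (by omega) le_rfl le_rfl (by omega) (by omega)
  have hD : genD ∈ V := of_smul hc hSD
    (adS_gridT_penultimate hn.le 1 ▸ hT (by omega) le_rfl le_rfl (by omega))
  /- `T_{2n}^1` is a multiple of `D` modulo the relations -/
  have hideal := fun (x : FreeSylvester) (y : FreeSylvester) (hy : y ∈ I) =>
    LieSuperalgebra.bracket_mem_idealSpan (freeLieSuperalgebra sylvesterParity)
      (sylvesterRelations n) x hy
  obtain ⟨⟨hDSI, hSDI⟩, -, hlastI, -, -, -, -, hSSI, -, -⟩ :=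
    forall_mem_sylvesterRelations.1 (LieSuperalgebra.subset_idealSpan
      (freeLieSuperalgebra sylvesterParity) (sylvesterRelations n))
  have hlastD' : ∀ k, 1 ≤ k → k ≤ 2 * n → adD (gridT n (2 * n) k) ∈ V := by
    intro k h1 h2
    rcases h1.eq_or_lt with rfl | h1
    · have h := hideal genD _ hSDI
      change adD _ ∈ _ at h
      rw [map_sub, map_smul, adD_genD, smul_zero, sub_zero, adS_gridT_penultimate hn.le] at h
      exact Submodule.mem_sup_right h
    rcases h2.eq_or_lt with rfl | h2
    · exact hidD
    by_cases hkn : k = n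
    · exact Submodule.mem_sup_right (by rw [hkn]; exact hideal genD _ hlastI)
    · exact hlastD k h1 (by omega) hkn
  -- For k = 1, T_{2n}^1 is a multiple of D modulo I, and [S, D] = -[D, S] is a multiple of T_1^1.
  have hlastS' : ∀ k, 1 ≤ k → k ≤ 2 * n → adS (gridT n (2 * n) k) ∈ V := by
    intro k h1 h2
    rcases h1.eq_or_lt with rfl | h1
    · have h := hideal genS _ hSDI
      change adS _ ∈ _ at h
      rw [map_sub, map_smul, adS_genD, ← T11, adS_gridT_penultimate hn.le, smul_neg,
        ← neg_smul] at h
      exact of_sub (Submodule.mem_sup_right h) (hT le_rfl (by omega) le_rfl (by omega))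
    rcases h2.eq_or_lt with rfl | h2
    · exact hidS
    by_cases hkn : k = n
    · exact Submodule.mem_sup_right (by rw [hkn]; exact hideal genS _ hlastI)
    · exact of_sub (hlastS k h1 (by omega) hkn) (hT le_rfl (by omega) (by omega) (by omega))
  /- the row `m = 2` closes up because `T_2^1` is a multiple of `[D, [S, S]]` -/
  have htwoD : adD (gridT n 2 (2 * n)) ∈ V := by
    have h := hideal genD _ hSSI
    change adD _ ∈ _ at h
    rw [map_sub, map_smul, adD_adS_genS, ← T11, adS_gridT_one le_rfl (by omega)] at h
    have h' := V.sub_mem (V.smul_mem 2 (hT (m := 1 + 1) (k := 1) (by omega) (by omega) le_rfl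
      (by omega))) (Submodule.mem_sup_right h)
    rw [sub_sub_cancel] at h'
    have h0 : (2 / gridCoeff n 2 (2 * n)) ≠ 0 := div_ne_zero two_ne_zero
      (gridCoeff_ne_zero hn (by omega) (by omega) (by omega) le_rfl (by omega))
    have h'' := V.smul_mem (2 / gridCoeff n 2 (2 * n))⁻¹ h'
    rwa [smul_smul, inv_mul_cancel₀ h0, one_smul] at h''
  -- Row 1 closes by bracketing (ad D)^{2n} S = b_1 S with D; rows from 3 on use their own
  -- relations.
  have hrowD : ∀ m, 1 ≤ m → m < 2 * n → adD (gridT n m (2 * n)) ∈ V := by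
    intro m h1 h2
    have e : adD (gridT n m (2 * n)) = (adD ^ (2 * n)) (gridT n m 1) := by
      rw [adD_gridT h2 (by omega), adD_pow_gridT h2 _ le_rfl, add_comm]
    by_cases hm1 : m = 1
    · subst hm1
      have h := hideal genD _ hDSI
      change adD _ ∈ _ at h
      rw [map_sub, map_smul, hpow, ← T11] at h
      exact of_sub (Submodule.mem_sup_right h) (hT le_rfl (by omega) le_rfl (by omega))
    by_cases hm2 : m = 2
    · rw [hm2]
      exact htwoD
    rw [e]
    exact of_sub (hrow m (by omega) (by omega)) (hT h1 h2.le le_rfl (by omega))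
  have hfirstS : ∀ k, 1 ≤ k → k ≤ 2 * n → adS (gridT n 1 k) ∈ V := by
    intro k h1 h2
    by_cases hk1 : k = 1
    · rw [hk1, adS_gridT_one le_rfl (by omega)]
      exact hT (by omega) (by omega) le_rfl (by omega)
    by_cases hk2 : k = 2
    · rw [hk2]
      exact of_sub htwo (hT (by omega) (by omega) (by omega) (by omega))
    rcases h2.eq_or_lt with rfl | h2
    -- At k = 2n, bracketing (ad D)^{2n} S = b_1 S with S turns [S, T_1^{2n}] into b_1 [S, S], a
    -- multiple of T_2^{2n} modulo I.
    · have h := hideal genS _ hDSI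
      change adS _ ∈ _ at h
      rw [map_sub, map_smul, hpow] at h
      exact of_sub (Submodule.mem_sup_right h)
        (of_sub hSS (hT (by omega) (by omega) (by omega) le_rfl))
    · exact of_sub (hfirst k (by omega) (by omega)) (hT (by omega) (by omega) (by omega) h2.le)
  apply span_sup_idealSpan_eq_top hD hS
  · rintro ⟨⟨k, hk⟩, ⟨m, hm⟩⟩
    change adD (gridT n (m + 1) (k + 1)) ∈ V
    by_cases hm' : m + 1 = 2 * n
    · rw [hm']
      exact hlastD' _ (by omega) (by omega)
    by_cases hk' : k + 1 = 2 * n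
    · rw [hk']
      exact hrowD _ (by omega) (by omega)
    rw [adD_gridT (by omega) (by omega)]
    exact hT (by omega) (by omega) (by omega) (by omega)
  · rintro ⟨⟨k, hk⟩, ⟨m, hm⟩⟩
    change adS (gridT n (m + 1) (k + 1)) ∈ V
    by_cases hm' : m + 1 = 2 * n
    · rw [hm']
      exact hlastS' _ (by omega) (by omega)
    by_cases hm2 : m + 1 = 2 * n - 1
    · rw [hm2, adS_gridT_penultimate hn.le]
      exact hT (by omega) le_rfl (by omega) (by omega)
    by_cases hm1 : m = 0
    · rw [hm1]
      exact hfirstS _ (by omega) (by omega)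
    by_cases hk1 : k = 0
    · rw [hk1, adS_gridT_one (by omega) (by omega)]
      exact hT (by omega) (by omega) (by omega) (by omega)
    exact of_sub (hstep _ _ (by omega) (by omega) (by omega) (by omega))
      (hT (by omega) (by omega) (by omega) (by omega))

theorem isDefiningSet_sylvesterRelations {n : ℕ} (hn : 1 < n) :
    IsDefiningSet n (sylvesterRelations n) := by
  refine isDefiningSet_of_span_sup_eq_top (isHomogeneous_of_mem_sylvesterRelations hn)
    (sylvesterEval_eq_zero_of_mem_sylvesterRelations hn)
    (linearIndependent_sylvesterMonomial hn.le)
    (fun x => sylvesterEval_gridT hn.le (by omega) (by omega) (by omega)) ?_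
    (span_gridT_sup_idealSpan hn)
  -- The only grid element with value zero is T_{2n}^n, and it is one of the relations.
  rintro ⟨⟨k, hk⟩, ⟨m, hm⟩⟩ h
  by_cases hmk : m + 1 = 2 * n ∧ k + 1 = n
  · change gridT n (m + 1) (k + 1) ∈ _
    rw [hmk.1, hmk.2]
    exact (forall_mem_sylvesterRelations.1 (LieSuperalgebra.subset_idealSpan _ _)).2.2.1
  · exact absurd h (gridCoeff_ne_zero hn (by omega) (by omega) (by omega) (by omega) hmk)

/-! ### The generated algebra is sl(n|n) -/

/-- The grid values span all monomials other than D^n, each of supertrace zero. Since the supertrace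
of D^n is nonzero, a supertraceless matrix has no D^n component. -/
theorem sylvesterSpan_eq_slSuper {n : ℕ} (hn : 1 < n) :
    sylvesterSpan n = slSuper (alternating n) := by
  rw [sylvesterSpan_eq_span (sylvesterEval_eq_zero_of_mem_sylvesterRelations hn)
    (fun x => sylvesterEval_gridT hn.le (by omega) (by omega) (by omega))
    (span_gridT_sup_idealSpan hn)]
  set E := fun x : Fin (2 * n) × Fin (2 * n) => sylvesterMonomial n (x.1 + 1) (x.2 + 1) with hE
  have hcoeff : ∀ x : Fin (2 * n) × Fin (2 * n), ¬ (x.2.val + 1 = 2 * n ∧ x.1.val + 1 = n) →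
      gridCoeff n (x.2 + 1) (x.1 + 1) ≠ 0 := fun x hx =>
    gridCoeff_ne_zero hn (by omega) (by omega) (by omega) (by omega) hx
  have htrace : ∀ x : Fin (2 * n) × Fin (2 * n), ¬ (x.2.val + 1 = 2 * n ∧ x.1.val + 1 = n) →
      supertrace (alternating n) (E x) = 0 := by
    intro x hx
    by_cases hm : x.2.val + 1 = 2 * n
    · rw [hE]
      simp only [hm]
      exact supertrace_sylvesterMonomial_of_ne hn.le (by omega) (by omega) fun h => hx ⟨hm, h⟩
    · exact supertrace_sylvesterMonomial_of_lt hn.le (by omega) (by omega)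
  have hlast : ∀ x : Fin (2 * n) × Fin (2 * n), x.2.val + 1 = 2 * n ∧ x.1.val + 1 = n →
      x = (⟨n - 1, by omega⟩, ⟨2 * n - 1, by omega⟩) := by
    intro x hx
    ext <;> simp only <;> omega
  apply le_antisymm
  · rw [Submodule.span_le]
    rintro _ ⟨x, rfl⟩
    change supertrace _ _ = 0
    rw [map_smul]
    by_cases hx : x.2.val + 1 = 2 * n ∧ x.1.val + 1 = n
    · rw [hx.1, hx.2, gridCoeff_eq_zero hn.le, zero_smul]
    · change _ • supertrace _ (E x) = 0
      rw [htrace x hx, smul_zero]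
  · intro A hA
    obtain ⟨c, rfl⟩ := (Submodule.mem_span_range_iff_exists_fun ℂ).1
      (span_sylvesterMonomial hn.le ▸ Submodule.mem_top (x := A))
    refine Submodule.sum_mem _ fun x _ => ?_
    by_cases hx : x.2.val + 1 = 2 * n ∧ x.1.val + 1 = n
    · change supertrace _ _ = 0 at hA
      rw [map_sum, Finset.sum_eq_single x, map_smul, smul_eq_mul, hx.1, hx.2] at hA
      · rw [(mul_eq_zero.1 hA).resolve_right (supertrace_sylvesterMonomial_self_ne_zero hn.le),
          zero_smul]
        exact Submodule.zero_mem _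
      · intro y _ hy
        rw [map_smul]
        change _ • supertrace _ (E y) = 0
        rw [htrace y fun h => hy ((hlast y h).trans (hlast x hx).symm), smul_zero]
      · simp
    · refine Submodule.smul_mem _ _ ?_
      have h := Submodule.smul_mem _ (gridCoeff n (x.2 + 1) (x.1 + 1))⁻¹
        (Submodule.subset_span (R := ℂ) (s := Set.range fun x : Fin (2 * n) × Fin (2 * n) =>
          gridCoeff n (x.2 + 1) (x.1 + 1) • E x) ⟨x, rfl⟩)
      rw [smul_smul, inv_mul_cancel₀ (hcoeff x hx), one_smul] at h
      exact h

/-! ### Counting the relations -/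

theorem encard_le_of_subset_image {α β : Type*} {s : Set β} {F : Finset α} {f : α → β}
    (h : s ⊆ f '' F) : s.encard ≤ F.card :=
  (Set.encard_le_encard h).trans ((Set.encard_image_le _ _).trans
    (Set.encard_coe_eq_coe_finsetCard F).le)

theorem encard_union_le_add {α : Type*} {s t : Set α} {a b : ℕ} (hs : s.encard ≤ a)
    (ht : t.encard ≤ b) : (s ∪ t).encard ≤ (a + b : ℕ) := by
  rw [Nat.cast_add]
  exact (Set.encard_union_le s t).trans (add_le_add hs ht)

theorem encard_pair_le_two {α : Type*} (x y : α) : ({x, y} : Set α).encard ≤ (2 : ℕ) := by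
  refine (Set.encard_insert_le _ _).trans ?_
  rw [Set.encard_singleton, one_add_one_eq_two]
  rfl

theorem encard_singleton_le_one {α : Type*} (x : α) : ({x} : Set α).encard ≤ (1 : ℕ) :=
  (Set.encard_singleton x).le

theorem encard_sylvesterRelations_le {n : ℕ} (hn : 1 < n) :
    (sylvesterRelations n).encard ≤ (((2 * n) ^ 2 - 1 : ℕ) : ℕ∞) := by
  have interval : ∀ (a b : ℕ) (f : ℕ → FreeSylvester),
      {x | ∃ k, a ≤ k ∧ k ≤ b ∧ x = f k}.encard ≤ (b + 1 - a : ℕ) := by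
    intro a b f
    rw [← Nat.card_Icc]
    refine encard_le_of_subset_image (f := f) ?_
    rintro _ ⟨k, h1, h2, rfl⟩
    exact ⟨k, by simp [h1, h2], rfl⟩
  have punctured : ∀ f : ℕ → FreeSylvester,
      {x | ∃ k, 2 ≤ k ∧ k ≤ 2 * n - 1 ∧ k ≠ n ∧ x = f k}.encard ≤
        (2 * n - 1 + 1 - 2 - 1 : ℕ) := by
    intro f
    have hmem : n ∈ Finset.Icc 2 (2 * n - 1) := by
      rw [Finset.mem_Icc]
      omega
    rw [← Nat.card_Icc, ← Finset.card_erase_of_mem hmem]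
    refine encard_le_of_subset_image (f := f) ?_
    rintro _ ⟨k, h1, h2, h3, rfl⟩
    exact ⟨k, by simp [h1, h2, h3], rfl⟩
  have rectangle : ∀ f : ℕ → ℕ → FreeSylvester,
      {x | ∃ m k, 2 ≤ m ∧ m + 2 ≤ 2 * n ∧ 2 ≤ k ∧ k ≤ 2 * n ∧ x = f m k}.encard ≤
        ((2 * n - 2 + 1 - 2) * (2 * n + 1 - 2) : ℕ) := by
    intro f
    rw [← Nat.card_Icc, ← Nat.card_Icc, ← Finset.card_product]
    refine encard_le_of_subset_image (f := fun x => f x.1 x.2) ?_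
    rintro _ ⟨m, k, h1, h2, h3, h4, rfl⟩
    refine ⟨(m, k), ?_, rfl⟩
    simp only [Finset.coe_product, Finset.coe_Icc, Set.mem_prod, Set.mem_Icc]
    omega
  refine (encard_union_le_add (encard_union_le_add (encard_union_le_add (encard_union_le_add
    (encard_union_le_add (encard_union_le_add (encard_union_le_add (encard_union_le_add
    (encard_union_le_add (encard_pair_le_two _ _) (interval _ _ _)) (encard_singleton_le_one _))
    (punctured _)) (punctured _)) (interval _ _ _)) (rectangle _)) (encard_singleton_le_one _))
    (encard_pair_le_two _ _)) (encard_singleton_le_one _)).trans ?_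
  -- With 2n = r + 3 the families contribute at most 2, r, 1, r, r, r, r(r + 2), 1, 2 and 1
  -- elements, in total (2n)² - 2, one below the stated bound.
  obtain ⟨r, hr⟩ : ∃ r, 2 * n = r + 3 := ⟨2 * n - 3, by omega⟩
  rw [hr, Nat.cast_le, show r + 3 - 2 + 1 - 2 = r by omega, show r + 3 + 1 - 2 = r + 2 by omega]
  have e : (r + 3) ^ 2 = r * (r + 2) + 4 * r + 9 := by ring
  omega

/-! ### Independence of the two paths to T_2^2 -/

/-- The two paths to `T_2^2` are linearly independent, as their values in a `(2|1)`-dimensional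
representation show. -/
theorem linearIndependent_two_paths :
    LinearIndependent ℂ ![adD (adS (adD genS)), adS (adD (adD genS))] := by
  let p : Fin 3 → ZMod 2 := ![0, 1, 0]
  -- The nonzero entries of `s` join neighbouring eigenvalues of `d`, so (ad d)² s = s and the
  -- second path becomes [s, s] = 2s².
  let d : Matrix (Fin 3) (Fin 3) ℂ := !![0, 0, 0; 0, 1, 0; 0, 0, 2]
  let s : Matrix (Fin 3) (Fin 3) ℂ := !![0, 1, 0; 1, 0, 1; 0, 0, 0]
  have hd : d ∈ matrixPart p 0 := by
    intro i j h
    fin_cases i <;> fin_cases j <;> first | rfl | exact absurd (by decide) h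
  have hs : s ∈ matrixPart p 1 := by
    intro i j h
    fin_cases i <;> fin_cases j <;> first | rfl | exact absurd (by decide) h
  let φ := (glSuper p).lift sylvesterParity (fun g => SylvesterGen.casesOn g d s)
    (by rintro (_ | _) <;> assumption)
  have hφD : ∀ x, φ.toLinearMap (adD x) = (glSuper p).bracket d (φ.toLinearMap x) := by
    intro x
    rw [adD, φ.map_bracket, genD, LieSuperalgebra.lift_freeGen]
  have hφS : ∀ x, φ.toLinearMap (adS x) = (glSuper p).bracket s (φ.toLinearMap x) := by
    intro x
    rw [adS, φ.map_bracket, genS, LieSuperalgebra.lift_freeGen]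
  have hgen : φ.toLinearMap genS = s := LieSuperalgebra.lift_freeGen _ _ _ _ _
  have odd : ∀ {y}, y ∈ matrixPart p 1 → (glSuper p).bracket s y = s * y + y * s := by
    intro y hy
    rw [matrixSuperbracket_odd (m := 1) hs (by simpa using hy)]
    simp
  have ad_mem : ∀ {y}, y ∈ matrixPart p 1 → d * y - y * d ∈ matrixPart p 1 := by
    intro y hy
    rw [← matrixSuperbracket_even hd hy, ← zero_add (1 : ZMod 2)]
    exact (glSuper p).bracket_mem hd hy
  have h1 : φ.toLinearMap (adD (adS (adD genS))) =
      d * (s * (d * s - s * d) + (d * s - s * d) * s) -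
        (s * (d * s - s * d) + (d * s - s * d) * s) * d := by
    rw [hφD, hφS, hφD, hgen, matrixSuperbracket_even hd hs,
      matrixSuperbracket_even hd ((glSuper p).bracket_mem hs (ad_mem hs)), odd (ad_mem hs)]
  have h2 : φ.toLinearMap (adS (adD (adD genS))) =
      s * (d * (d * s - s * d) - (d * s - s * d) * d) +
        (d * (d * s - s * d) - (d * s - s * d) * d) * s := by
    rw [hφS, hφD, hφD, hgen, matrixSuperbracket_even hd hs, matrixSuperbracket_even hd (ad_mem hs),
      odd (ad_mem (ad_mem hs))]
  rw [LinearIndependent.pair_iff]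
  intro x y hxy
  have h := congrArg φ.toLinearMap hxy
  rw [map_add, map_smul, map_smul, h1, h2, map_zero] at h
  -- The two values are 4E_{02} and 2(E_{00} + E_{11} + E_{02}): the entry (0, 0) isolates `y`, then
  -- (0, 2) gives `x`.
  have h00 := congrFun (congrFun h 0) 0
  have h02 := congrFun (congrFun h 0) 2
  simp [d, s] at h00 h02
  refine ⟨?_, h00⟩
  rw [h00] at h02
  linear_combination h02 / 4

/-! ### The case n = 1 -/

/-- The elements `T_m^k` for `n = 1`, with the multiples `S`, `D` and `[S, S]` of basis matrices
chosen as in the relations. -/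
noncomputable def gridOne (x : Fin (2 * 1) × Fin (2 * 1)) : FreeSylvester :=
  (![![adD genS, genD], ![genS, adS genS]] : Fin 2 → Fin 2 → FreeSylvester) x.1 x.2

/-- The coefficients of the values of `gridOne` at Sylvester's matrices. -/
noncomputable def gridOneCoeff (x : Fin (2 * 1) × Fin (2 * 1)) : ℂ :=
  (![![2, 1], ![1, 2]] : Fin 2 → Fin 2 → ℂ) x.1 x.2

theorem sylvesterRoot_one : sylvesterRoot 1 = -1 := by
  simpa using sylvesterRoot_pow_self (le_refl 1)

theorem sylvesterEval_gridOne (x : Fin (2 * 1) × Fin (2 * 1)) :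
    (sylvesterEval 1).toLinearMap (gridOne x) =
      gridOneCoeff x • sylvesterMonomial 1 (x.1 + 1) (x.2 + 1) := by
  obtain ⟨i, j⟩ := x
  -- Exponents count modulo 2, so D, S and S² occupy the places D S², D² S and D² S² of the basis.
  have h2 := sylvesterMonomial_add_period_right 1
  have h2' := sylvesterMonomial_add_period_left (le_refl 1)
  fin_cases i <;> fin_cases j
  · have h := sylvesterEval_adD_genS (le_refl 1)
    rw [sylvesterRoot_one] at h
    norm_num at h
    exact h
  · exact (sylvesterEval_genD 1).trans (congrArg _ (h2 1 0).symm)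
  · exact (sylvesterEval_genS 1).trans (congrArg _ (h2' 0 1).symm)
  · exact (sylvesterEval_adS_genS (le_refl 1)).trans (congrArg _ (h2' 0 2).symm)

theorem sylvesterEval_eq_zero_of_mem_relationsOne :
    ∀ x ∈ relationsOne, (sylvesterEval 1).toLinearMap x = 0 := by
  have hD := @sylvesterEval_adD_of_eq 1 le_rfl
  have hS := @sylvesterEval_adS_of_eq 1 le_rfl
  have h1 := sylvesterEval_adD_genS (le_refl 1)
  rintro x (rfl | rfl | rfl | rfl)
  · rw [map_sub, map_smul, hD h1, sylvesterEval_genS, sylvesterRoot_one,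
      ← sylvesterMonomial_add_period_left (le_refl 1) 0 1, smul_smul, ← sub_smul]
    norm_num
  · rw [hS h1, sylvesterRoot_one]
    norm_num
  · rw [hD (sylvesterEval_adS_genS (le_refl 1)), sylvesterRoot_one]
    norm_num
  · rw [hS (sylvesterEval_adS_genS (le_refl 1)), sylvesterRoot_one]
    norm_num

theorem isHomogeneous_of_mem_relationsOne :
    ∀ x ∈ relationsOne, (freeLieSuperalgebra sylvesterParity).IsHomogeneous x := by
  rintro x (rfl | rfl | rfl | rfl)
  · exact ⟨1, Submodule.sub_mem _ (adD_mem_part (adD_mem_part genS_mem_part))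
      (Submodule.smul_mem _ _ genS_mem_part)⟩
  · exact ⟨_, adS_mem_part (adD_mem_part genS_mem_part)⟩
  · exact ⟨_, adD_mem_part (adS_mem_part genS_mem_part)⟩
  · exact ⟨_, adS_mem_part (adS_mem_part genS_mem_part)⟩

theorem span_gridOne_sup_idealSpan :
    Submodule.span ℂ (Set.range gridOne) ⊔
      (freeLieSuperalgebra sylvesterParity).idealSpan relationsOne = ⊤ := by
  set V := Submodule.span ℂ (Set.range gridOne) ⊔
    (freeLieSuperalgebra sylvesterParity).idealSpan relationsOne
  have hT : ∀ x, gridOne x ∈ V := fun x =>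
    Submodule.mem_sup_left (Submodule.subset_span ⟨x, rfl⟩)
  have hR : ∀ x ∈ relationsOne, x ∈ V := fun x hx =>
    Submodule.mem_sup_right (LieSuperalgebra.subset_idealSpan _ _ hx)
  have hDS : adD genS ∈ V := hT (0, 0)
  have hD : genD ∈ V := hT (0, 1)
  have hS : genS ∈ V := hT (1, 0)
  have hSS : adS genS ∈ V := hT (1, 1)
  apply span_sup_idealSpan_eq_top hD hS
  · rintro ⟨i, j⟩
    fin_cases i <;> fin_cases j
    · change adD (adD genS) ∈ V
      have h := V.add_mem (hR _ (.inl rfl)) (V.smul_mem 4 hS)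
      rwa [sub_add_cancel] at h
    · change adD genD ∈ V
      rw [adD_genD]
      exact V.zero_mem
    · exact hDS
    · exact hR _ (.inr (.inr (.inl rfl)))
  · rintro ⟨i, j⟩
    fin_cases i <;> fin_cases j
    · exact hR _ (.inr (.inl rfl))
    · change adS genD ∈ V
      rw [adS_genD]
      exact V.neg_mem hDS
    · exact hSS
    · exact hR _ (.inr (.inr (.inr rfl)))

theorem gridOneCoeff_ne_zero (x : Fin (2 * 1) × Fin (2 * 1)) : gridOneCoeff x ≠ 0 := by
  obtain ⟨i, j⟩ := x
  fin_cases i <;> fin_cases j <;> simp [gridOneCoeff]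

theorem isDefiningSet_relationsOne : IsDefiningSet 1 relationsOne :=
  isDefiningSet_of_span_sup_eq_top isHomogeneous_of_mem_relationsOne
    sylvesterEval_eq_zero_of_mem_relationsOne (linearIndependent_sylvesterMonomial le_rfl)
    sylvesterEval_gridOne (fun x h => absurd h (gridOneCoeff_ne_zero x))
    span_gridOne_sup_idealSpan

/-- In contrast to n > 1, all four coefficients are nonzero: D = D^n is itself a generator, so no
monomial is missing. -/
theorem sylvesterSpan_one : sylvesterSpan 1 = ⊤ := by
  rw [sylvesterSpan_eq_span sylvesterEval_eq_zero_of_mem_relationsOne sylvesterEval_gridOne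
    span_gridOne_sup_idealSpan, eq_top_iff, ← span_sylvesterMonomial (le_refl 1),
    Submodule.span_le]
  rintro _ ⟨x, rfl⟩
  have h := Submodule.smul_mem _ (gridOneCoeff x)⁻¹
    (Submodule.subset_span (R := ℂ) (s := Set.range fun x : Fin (2 * 1) × Fin (2 * 1) =>
      gridOneCoeff x • sylvesterMonomial 1 (x.1 + 1) (x.2 + 1)) ⟨x, rfl⟩)
  rw [smul_smul, inv_mul_cancel₀ (gridOneCoeff_ne_zero x), one_smul] at h
  exact h

theorem encard_relationsOne_le : relationsOne.encard ≤ 4 := by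
  refine (encard_union_le_add (s := {_}) (encard_singleton_le_one _)
    (encard_union_le_add (s := {_}) (encard_singleton_le_one _) (encard_pair_le_two _ _))).trans ?_
  norm_num

theorem sylvesterEval_gridT_identity {n : ℕ} (hn : 1 ≤ n) :
    (sylvesterEval n).toLinearMap (gridT n (2 * n) (2 * n)) = gridCoeff n (2 * n) (2 * n) • 1 := by
  rw [sylvesterEval_gridT hn (by omega) le_rfl (by omega), ← sylvesterMonomial_zero_zero,
    ← sylvesterMonomial_add_period_left hn 0 0, zero_add,
    ← sylvesterMonomial_add_period_right n (2 * n) 0, zero_add]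

theorem mainTheorem4 (n : ℕ) (hn : 1 ≤ n) :
    (n = 1 →
      sylvesterSpan n = ⊤ ∧
      IsDefiningSet n relationsOne ∧
      relationNumber n ≤ 4) ∧
    (1 < n →
      sylvesterSpan n = slSuper (alternating n) ∧
      relationNumber n ≤ (((2 * n) ^ 2 - 1 : ℕ) : ℕ∞) ∧
      (∃ z : ℂ, z ≠ 0 ∧ (sylvesterEval n).toLinearMap (gridT n (2 * n) (2 * n)) = z • 1) ∧
      LinearIndependent ℂ ![adD (adS (adD genS)), adS (adD (adD genS))] ∧
      ∃ (b : ℕ → ℂ) (c : ℕ → ℕ → ℂ) (d : ℂ),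
        IsDefiningSet n
          (relationsGrid n b c d ∪ relationsIdentity n ∪ {relationTwoTwo n (c 1 2)}) ∧
        (relationsGrid n b c d ∪ relationsIdentity n ∪ {relationTwoTwo n (c 1 2)}).encard ≤
          (((2 * n) ^ 2 - 1 : ℕ) : ℕ∞)) := by
  refine ⟨?_, fun h => ⟨sylvesterSpan_eq_slSuper h,
    (relationNumber_le (isDefiningSet_sylvesterRelations h)).trans
      (encard_sylvesterRelations_le h),
    ⟨_, gridCoeff_ne_zero h (by omega) le_rfl (by omega) le_rfl (by omega),
      sylvesterEval_gridT_identity hn⟩, linearIndependent_two_paths, _, _, _,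
    isDefiningSet_sylvesterRelations h, encard_sylvesterRelations_le h⟩⟩
  rintro rfl
  exact ⟨sylvesterSpan_one, isDefiningSet_relationsOne,
    (relationNumber_le isDefiningSet_relationsOne).trans encard_relationsOne_le⟩
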